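/- \textbf{Setting and conventions.} Theories are closed under deduction; languages may be many-sorted; every sort of a structure is nonempty. Let $\mathcal L_0\subseteq\mathcal L$ be first-order languages with the same sorts. Let $T_0$ be a complete and model complete $\mathcal L_0$-theory and let $T$ be an $\mathcal L$-theory with $T_0\subseteq T$. Suppose $T$ has a model companion $T_+$ with $T\subseteq T_+$. Here a monster model is a structure that is $\kappa$-saturated and strongly $\kappa$-homogeneous for some uncountable $\kappa$ larger than the language; small means of size $<\kappa$. Let $\mathcal U_0$ be a monster model of $T_0$ with cardinal $\kappa_0$, and $\mathcal U_+$ a monster model of a completion of $T_+$ with cardinal $\kappa_+\le\kappa_0$ such that $\mathcal U_+$ is an $\mathcal L_0$-substructure of $\mathcal U_0$. Let $\operatorname{acl}_0$ and $\operatorname{acl}_+$ be the algebraic closures in the $\mathcal L_0$-structure $\mathcal U_0$ and the $\mathcal L$-structure $\mathcal U_+$. Sets and tuples (possibly infinite) below are small. Write $\leq_{\mathcal L}$ for "is an $\mathcal L$-substructure of", $\langle\cdot\rangle_{\mathcal L_0}$ for the generated $\mathcal L_0$-substructure, and $T^\forall$ for the set of universal consequences of $T$. Juxtaposition of sets denotes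 union. Let $\perp^0$ be an automorphism-invariant ternary relation on small subsets of $\mathcal U_0$. On small subsets of $\mathcal U_+$ define $$A\perp^+_C B\iff \operatorname{acl}_+(AC)\ \perp^0_{\operatorname{acl}_+(C)}\ \operatorname{acl}_+(BC).$$ An automorphism-invariant relation $\perp$ on triples of small subsets of a monster model is an \emph{independence relation} if it satisfies, for all small sets: \begin{itemize} \item normality: $A\perp_C B\Rightarrow A\perp_C BC$; \item monotonicity: $A\perp_C BD\Rightarrow A\perp_C B$; \item base monotonicity: $A\perp_C BD\Rightarrow A\perp_{CD}B$; \item transitivity: if $C\subseteq B\subseteq D$, $A\perp_C B$ and $A\perp_B D$, then $A\perp_C D$; \item symmetry: $A\perp_C B\Rightarrow B\perp_C A$; \item full existence: for all $A,B,C$ there is $A'\equiv_C A$ with $A'\perp_C B$; \item finite character: if $A_0\perp_C B$ for all finite $A_0\subseteq A$, then $A\perp_C B$; \item local character: for every $A$ there is a small cardinal $\mu$ such that every $B$ has a subset $C$ with $|C|<\mu$ and $A\perp_C B$. \end{itemize} For a small set $M$, we say that $\perp_M$ satisfies monotonicity or symmetry if the property above holds for $C=M$; that $\perp_M$ satisfies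 extension if $A\perp_M B$ implies that for every $D$ there is $A'\equiv_{BM}A$ with $A'\perp_M BD$; and that $\perp$ satisfies the \emph{independence theorem over $M$} if, whenever $A_1\perp_M A_2$, $a_1\perp_M A_1$, $a_2\perp_M A_2$ and $a_1\equiv_M a_2$, there is $a\models\operatorname{tp}(a_1/MA_1)\cup\operatorname{tp}(a_2/MA_2)$ with $a\perp_M A_1A_2$. For $\perp^0$ and $\perp^+$ these notions are taken in $\mathcal U_0$ and $\mathcal U_+$ respectively. Let $\perp^1$ be a ternary relation on small subsets of $\mathcal U_0$. We say that $T$ is \emph{derivation-like with respect to $(T_0,\perp^1)$} if, whenever $A,B,C\models T^\forall$ are small, $C$ is a common $\mathcal L$-substructure of $A$ and $B$, $A,B\leq_{\mathcal L_0}\mathcal U_0$, $\operatorname{acl}_0(C)\cap A=\operatorname{acl}_0(C)\cap B=C$ and $A\perp^1_C B$, then \begin{enumerate} \item[(i)] there is $N\models T$ with $N\leq_{\mathcal L_0}\mathcal U_0$ and $A,B\leq_{\mathcal L}N$; and \item[(ii)] for every $N$ as in (i) and every $\mathcal L_0$-structure $D$ with $\langle A,B\rangle_{\mathcal L_0}\leq_{\mathcal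 L_0}D\leq_{\mathcal L_0}\operatorname{acl}_0(A,B)\cap N$, we have $D\leq_{\mathcal L}N$, and this $\mathcal L$-structure on $D$ is the unique one that expands its $\mathcal L_0$-structure, makes it a model of $T^\forall$, and extends the $\mathcal L$-structures of $A$ and $B$. \end{enumerate} \textbf{Theorem.} Let $M\models T_+$ be a small $\mathcal L$-substructure of $\mathcal U_+$. Let $\perp^1$ be an independence relation on small subsets of $\mathcal U_0$ such that $A\perp^0_M B$ implies $A\perp^1_M B$ for all small $A,B\subseteq\mathcal U_0$, and such that $T$ is derivation-like with respect to $(T_0,\perp^1)$. Suppose $\perp^0_M$ satisfies monotonicity, symmetry and extension. If $\perp^0$ satisfies the independence theorem over $M$, then $\perp^+$ satisfies the independence theorem over $M$. -/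

import Mathlib

universe u

namespace ManySorted

/-! ### Many-sorted first-order logic over a fixed set of sorts `S` -/

/-- A many-sorted first-order language with set of sorts `S`: function symbols have a list of
argument sorts and a value sort, relation symbols have a list of argument sorts. -/
structure Language (S : Type u) where
  Functions : List S → S → Type u
  Relations : List S → Type u

variable {S : Type u}

/-- The number of sorts and non-logical symbols. -/
noncomputable def Language.card (L : Language S) : Cardinal.{u} :=
  Cardinal.mk S + Cardinal.mk (Σ w : List S, Σ s : S, L.Functions w s) +
    Cardinal.mk (Σ w : List S, L.Relations w)

/-- A map of languages (identity on sorts). -/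
structure Language.Hom (L₀ L : Language S) where
  onFunction : ∀ {w : List S} {s : S}, L₀.Functions w s → L.Functions w s
  onRelation : ∀ {w : List S}, L₀.Relations w → L.Relations w

/-- An injective map of languages exhibits `L₀` as a sublanguage of `L`. -/
def Language.Hom.Injective {L₀ L : Language S} (i : L₀.Hom L) : Prop :=
  (∀ (w : List S) (s : S), Function.Injective (i.onFunction : L₀.Functions w s → _)) ∧
    ∀ w : List S, Function.Injective (i.onRelation : L₀.Relations w → _)

/-- The positions of sort `s` in the list `Γ` of sorts; these serve as bound variables. -/
inductive BVar : List S → S → Type u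
  | zero {Γ : List S} {s : S} : BVar (s :: Γ) s
  | succ {Γ : List S} {s t : S} : BVar Γ s → BVar (t :: Γ) s

/-- Terms whose variables of sort `s` are the elements of `V s`. -/
inductive Language.Term (L : Language S) (V : S → Type u) : S → Type u
  | var {s : S} : V s → L.Term V s
  | func {w : List S} {s : S} : L.Functions w s → (∀ i : Fin w.length, L.Term V (w.get i)) →
      L.Term V s

/-- Formulas with free variables `V` and, in addition, de Bruijn variables with sorts listed
in `Γ`. -/
inductive Language.BFormula (L : Language S) (V : S → Type u) : List S → Type u
  | falsum {Γ : List S} : L.BFormula V Γ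
  | equal {Γ : List S} {s : S} : L.Term (fun s => V s ⊕ BVar Γ s) s →
      L.Term (fun s => V s ⊕ BVar Γ s) s → L.BFormula V Γ
  | rel {Γ : List S} {w : List S} : L.Relations w →
      (∀ i : Fin w.length, L.Term (fun s => V s ⊕ BVar Γ s) (w.get i)) → L.BFormula V Γ
  | imp {Γ : List S} : L.BFormula V Γ → L.BFormula V Γ → L.BFormula V Γ
  | all {Γ : List S} {s : S} : L.BFormula V (s :: Γ) → L.BFormula V Γ

/-- Formulas with free variables `V`. -/
abbrev Language.Formula (L : Language S) (V : S → Type u) : Type u := L.BFormula V []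

/-- Sentences. -/
abbrev Language.Sentence (L : Language S) : Type u := L.Formula (fun _ => PEmpty.{u + 1})

/-- Theories. -/
abbrev Language.Theory (L : Language S) : Type u := Set L.Sentence

/-- Negation. -/
def Language.BFormula.not {L : Language S} {V : S → Type u} {Γ : List S} (φ : L.BFormula V Γ) :
    L.BFormula V Γ := φ.imp .falsum

/-- The image of a term under a map of languages. -/
def Language.Term.map {L₀ L : Language S} (i : L₀.Hom L) {V : S → Type u} :
    ∀ {s : S}, L₀.Term V s → L.Term V s
  | _, .var x => .var x
  | _, .func f ts => .func (i.onFunction f) fun j => (ts j).map i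

/-- The image of a formula under a map of languages. -/
def Language.BFormula.map {L₀ L : Language S} (i : L₀.Hom L) {V : S → Type u} :
    ∀ {Γ : List S}, L₀.BFormula V Γ → L.BFormula V Γ
  | _, .falsum => .falsum
  | _, .equal t₁ t₂ => .equal (t₁.map i) (t₂.map i)
  | _, .rel R ts => .rel (i.onRelation R) fun j => (ts j).map i
  | _, .imp φ ψ => .imp (φ.map i) (ψ.map i)
  | _, .all φ => .all (φ.map i)

/-- Quantifier-free formulas. -/
inductive Language.BFormula.IsQF {L : Language S} {V : S → Type u} {Γ : List S} :
    L.BFormula V Γ → Prop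
  | falsum : IsQF .falsum
  | equal {s : S} (t₁ t₂ : L.Term (fun s => V s ⊕ BVar Γ s) s) : IsQF (.equal t₁ t₂)
  | rel {w : List S} (R : L.Relations w)
      (ts : ∀ i : Fin w.length, L.Term (fun s => V s ⊕ BVar Γ s) (w.get i)) : IsQF (.rel R ts)
  | imp {φ ψ : L.BFormula V Γ} : IsQF φ → IsQF ψ → IsQF (φ.imp ψ)

/-- Universal formulas: a block of universal quantifiers followed by a quantifier-free formula. -/
inductive Language.BFormula.IsUniversal {L : Language S} {V : S → Type u} :
    ∀ {Γ : List S}, L.BFormula V Γ → Prop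
  | of_isQF {Γ : List S} {φ : L.BFormula V Γ} : φ.IsQF → IsUniversal φ
  | all {Γ : List S} {s : S} {φ : L.BFormula V (s :: Γ)} : IsUniversal φ → IsUniversal φ.all

/-- An `L`-structure with universes `M s`, `s : S`. As usual, universes are nonempty. -/
@[ext]
structure Language.Structure (L : Language S) (M : S → Type u) where
  nonempty : ∀ s : S, Nonempty (M s)
  funMap : ∀ {w : List S} {s : S}, L.Functions w s → (∀ i : Fin w.length, M (w.get i)) → M s
  relMap : ∀ {w : List S}, L.Relations w → (∀ i : Fin w.length, M (w.get i)) → Prop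

/-- The reduct of a structure along a map of languages. -/
def Language.Structure.reduct {L₀ L : Language S} {M : S → Type u} (i : L₀.Hom L)
    (𝓜 : L.Structure M) : L₀.Structure M where
  nonempty := 𝓜.nonempty
  funMap f := 𝓜.funMap (i.onFunction f)
  relMap R := 𝓜.relMap (i.onRelation R)

/-- The empty assignment. -/
def envNil {M : S → Type u} : ∀ s : S, BVar ([] : List S) s → M s := fun _ i => nomatch i

/-- Extending an assignment of the de Bruijn variables by a value for a new variable. -/
def envCons {M : S → Type u} {Γ : List S} {t : S} (x : M t) (xs : ∀ s : S, BVar Γ s → M s) :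
    ∀ s : S, BVar (t :: Γ) s → M s
  | _, .zero => x
  | _, .succ i => xs _ i

/-- The value of a term. -/
def Language.Term.realize {L : Language S} {M V : S → Type u} (𝓜 : L.Structure M)
    (v : ∀ s : S, V s → M s) : ∀ {s : S}, L.Term V s → M s
  | _, .var x => v _ x
  | _, .func f ts => 𝓜.funMap f fun j => (ts j).realize 𝓜 v

/-- Satisfaction of a formula. -/
def Language.BFormula.Realize {L : Language S} {M V : S → Type u} (𝓜 : L.Structure M)
    (v : ∀ s : S, V s → M s) : ∀ {Γ : List S}, L.BFormula V Γ → (∀ s : S, BVar Γ s → M s) → Prop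
  | _, .falsum, _ => False
  | _, .equal t₁ t₂, xs =>
      t₁.realize 𝓜 (fun s => Sum.elim (v s) (xs s)) = t₂.realize 𝓜 (fun s => Sum.elim (v s) (xs s))
  | _, .rel R ts, xs => 𝓜.relMap R fun j => (ts j).realize 𝓜 (fun s => Sum.elim (v s) (xs s))
  | _, .imp φ ψ, xs => φ.Realize 𝓜 v xs → ψ.Realize 𝓜 v xs
  | _, .all φ, xs => ∀ x, φ.Realize 𝓜 v (envCons x xs)

/-- `𝓜 ⊨ T`. -/
def Language.Structure.Models {L : Language S} {M : S → Type u} (𝓜 : L.Structure M)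
    (T : L.Theory) : Prop :=
  ∀ φ ∈ T, φ.Realize 𝓜 (fun _ x => nomatch x) envNil

/-- `T ⊢ φ`, that is, `φ` belongs to the deductive closure of `T`. -/
def Language.Theory.Entails {L : Language S} (T : L.Theory) (φ : L.Sentence) : Prop :=
  ∀ (M : S → Type u) (𝓜 : L.Structure M), 𝓜.Models T → 𝓜.Models {φ}

/-- `T ⊆ T'` for (deductive closures of) theories in the same language. -/
def Language.Theory.Le {L : Language S} (T T' : L.Theory) : Prop := ∀ φ ∈ T, T'.Entails φ

/-- `T₀ ⊆ T` for (deductive closures of) theories, where the language of `T₀` is a sublanguage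
of that of `T`. -/
def Language.Theory.LeAlong {L₀ L : Language S} (i : L₀.Hom L) (T₀ : L₀.Theory) (T : L.Theory) :
    Prop :=
  ∀ φ ∈ T₀, T.Entails (φ.map i)

/-- `T` is complete: it is consistent and decides every sentence. -/
def Language.Theory.IsComplete {L : Language S} (T : L.Theory) : Prop :=
  (∃ (M : S → Type u) (𝓜 : L.Structure M), 𝓜.Models T) ∧
    ∀ φ : L.Sentence, T.Entails φ ∨ T.Entails φ.not

/-- `T^∀`, the set of universal consequences of `T`. -/
def Language.Theory.universalPart {L : Language S} (T : L.Theory) : L.Theory :=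
  {φ | φ.IsUniversal ∧ T.Entails φ}

/-- `f` is an embedding of `L`-structures. -/
structure IsEmbedding {L : Language S} {M N : S → Type u} (𝓜 : L.Structure M)
    (𝓝 : L.Structure N) (f : ∀ s : S, M s → N s) : Prop where
  injective : ∀ s : S, Function.Injective (f s)
  map_fun : ∀ {w : List S} {s : S} (F : L.Functions w s) (x : ∀ i : Fin w.length, M (w.get i)),
    f s (𝓜.funMap F x) = 𝓝.funMap F fun i => f _ (x i)
  map_rel : ∀ {w : List S} (R : L.Relations w) (x : ∀ i : Fin w.length, M (w.get i)),
    𝓝.relMap R (fun i => f _ (x i)) ↔ 𝓜.relMap R x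

/-- `f` is an elementary map: it preserves the truth of all formulas with parameters from `M`. -/
def IsElementary {L : Language S} {M N : S → Type u} (𝓜 : L.Structure M) (𝓝 : L.Structure N)
    (f : ∀ s : S, M s → N s) : Prop :=
  ∀ φ : L.Formula M, φ.Realize 𝓝 f envNil ↔ φ.Realize 𝓜 (fun _ x => x) envNil

/-- `σ` is an automorphism. -/
def IsAutomorphism {L : Language S} {M : S → Type u} (𝓜 : L.Structure M)
    (σ : ∀ s : S, M s → M s) : Prop :=
  IsEmbedding 𝓜 𝓜 σ ∧ ∀ s : S, Function.Surjective (σ s)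

/-- `T` is model complete: every embedding between models of `T` is elementary. -/
def Language.Theory.IsModelComplete {L : Language S} (T : L.Theory) : Prop :=
  ∀ (M N : S → Type u) (𝓜 : L.Structure M) (𝓝 : L.Structure N), 𝓜.Models T → 𝓝.Models T →
    ∀ f : ∀ s : S, M s → N s, IsEmbedding 𝓜 𝓝 f → IsElementary 𝓜 𝓝 f

/-- `Tplus` is the model companion of `T`: it is model complete, every model of `T` embeds in a model
of `Tplus`, and every model of `Tplus` embeds in a model of `T`. -/
def Language.Theory.IsModelCompanion {L : Language S} (Tplus T : L.Theory) : Prop :=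
  Tplus.IsModelComplete ∧
    (∀ (M : S → Type u) (𝓜 : L.Structure M), 𝓜.Models T →
      ∃ (N : S → Type u) (𝓝 : L.Structure N) (f : ∀ s : S, M s → N s),
        𝓝.Models Tplus ∧ IsEmbedding 𝓜 𝓝 f) ∧
    ∀ (M : S → Type u) (𝓜 : L.Structure M), 𝓜.Models Tplus →
      ∃ (N : S → Type u) (𝓝 : L.Structure N) (f : ∀ s : S, M s → N s),
        𝓝.Models T ∧ IsEmbedding 𝓜 𝓝 f

/-! ### Sets, types, algebraic closure, monster models -/

/-- A subset of a many-sorted structure. Union, intersection and inclusion are `⊔`, `⊓`, `≤`. -/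
abbrev SortedSet (M : S → Type u) : Type u := ∀ s : S, Set (M s)

/-- A family of types indexed by the sorts has fewer than `κ` elements altogether. -/
def CardLT (κ : Cardinal.{u}) (V : S → Type u) : Prop := Cardinal.mk (Σ s : S, V s) < κ

/-- A subset has fewer than `κ` elements. -/
def SortedSet.IsSmall {M : S → Type u} (κ : Cardinal.{u}) (A : SortedSet M) : Prop :=
  CardLT κ fun s => A s

/-- The image of a subset. -/
def SortedSet.image {M N : S → Type u} (f : ∀ s : S, M s → N s) (A : SortedSet M) : SortedSet N :=
  fun s => f s '' A s

/-- The set of entries of a tuple. -/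
def SortedSet.range {I M : S → Type u} (a : ∀ s : S, I s → M s) : SortedSet M := fun s => Set.range (a s)

/-- The tuple enumerating a set by itself. -/
def SortedSet.incl {M : S → Type u} (A : SortedSet M) : ∀ s : S, A s → M s := fun _ x => x.1

section

variable {L : Language S} {M : S → Type u} (𝓜 : L.Structure M)

/-- `a ≡_C b`, that is, `tp(a/C) = tp(b/C)`, for tuples with the same index set (of any size). -/
def Language.Structure.TypeEq (C : SortedSet M) {I : S → Type u} (a b : ∀ s : S, I s → M s) : Prop :=
  ∀ φ : L.Formula (fun s => I s ⊕ C s),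
    φ.Realize 𝓜 (fun s => Sum.elim (a s) (C.incl s)) envNil ↔
      φ.Realize 𝓜 (fun s => Sum.elim (b s) (C.incl s)) envNil

/-- The set of realisations in sort `s` of a formula in one variable with parameters in `C`. -/
def Language.Structure.solutions (C : SortedSet M) {s : S} (φ : L.BFormula (fun s => C s) [s]) :
    Set (M s) :=
  {x | φ.Realize 𝓜 C.incl (envCons x envNil)}

/-- The model-theoretic algebraic closure. -/
def Language.Structure.acl (C : SortedSet M) : SortedSet M :=
  fun s => {x | ∃ φ : L.BFormula (fun s => C s) [s],
    (𝓜.solutions C φ).Finite ∧ x ∈ 𝓜.solutions C φ}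

/-- `κ`-saturation: every finitely satisfiable set of formulas in one variable over fewer than `κ`
parameters is realised. -/
def Language.Structure.IsSaturated (κ : Cardinal.{u}) : Prop :=
  ∀ C : SortedSet M, C.IsSmall κ → ∀ (s : S) (p : Set (L.BFormula (fun s => C s) [s])),
    (∀ q : Finset (L.BFormula (fun s => C s) [s]), ↑q ⊆ p →
      ∃ x : M s, ∀ φ ∈ q, x ∈ 𝓜.solutions C φ) →
    ∃ x : M s, ∀ φ ∈ p, x ∈ 𝓜.solutions C φ

/-- Strong `κ`-homogeneity: tuples of length less than `κ` with the same type (over the empty set)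
are conjugate under an automorphism. -/
def Language.Structure.IsStronglyHomogeneous (κ : Cardinal.{u}) : Prop :=
  ∀ (I : S → Type u) (a b : ∀ s : S, I s → M s), CardLT κ I → 𝓜.TypeEq ⊥ a b →
    ∃ σ : ∀ s : S, M s → M s, IsAutomorphism 𝓜 σ ∧ ∀ (s : S) (j : I s), σ s (a s j) = b s j

/-- `𝓜` is a monster model (of its complete theory), where sets of size less than `κ` are the
small ones: it is `κ`-saturated and strongly `κ`-homogeneous, where `κ` is uncountable and larger
than the language. -/
structure Language.Structure.IsMonster (κ : Cardinal.{u}) : Prop where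
  aleph0_lt : Cardinal.aleph0 < κ
  card_lt : L.card < κ
  saturated : 𝓜.IsSaturated κ
  homogeneous : 𝓜.IsStronglyHomogeneous κ

/-- `A` is (the universe of) a substructure. -/
def Language.Structure.IsSubstructure (A : SortedSet M) : Prop :=
  ∃ 𝓐 : L.Structure (fun s => A s), IsEmbedding 𝓐 𝓜 A.incl

/-- `A` is (the universe of) a substructure which is a model of `T`. -/
def Language.Structure.IsSubmodel (T : L.Theory) (A : SortedSet M) : Prop :=
  ∃ 𝓐 : L.Structure (fun s => A s), IsEmbedding 𝓐 𝓜 A.incl ∧ 𝓐.Models T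

/-- The smallest substructure containing `A`. -/
def Language.Structure.closure (A : SortedSet M) : SortedSet M :=
  sInf {B | 𝓜.IsSubstructure B ∧ A ≤ B}

end

/-! ### Ternary relations and independence relations -/

/-- Ternary relations on subsets; `R A C B` stands for the independence of `A` from `B` over `C`.
Only its values on small sets ever matter. -/
abbrev TernaryRel (M : S → Type u) : Type u := SortedSet M → SortedSet M → SortedSet M → Prop

section

variable {L : Language S} {M : S → Type u} (𝓜 : L.Structure M) (κ : Cardinal.{u})
  (R : TernaryRel M)

/-- Invariance under automorphisms. -/
def Language.Structure.Invariant : Prop :=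
  ∀ σ : ∀ s : S, M s → M s, IsAutomorphism 𝓜 σ → ∀ A B C : SortedSet M,
    A.IsSmall κ → B.IsSmall κ → C.IsSmall κ → R A C B → R (A.image σ) (C.image σ) (B.image σ)

/-- Monotonicity over `C`. -/
def MonotonicityOver (C : SortedSet M) : Prop :=
  ∀ A B D : SortedSet M, A.IsSmall κ → B.IsSmall κ → D.IsSmall κ → R A C (B ⊔ D) → R A C B

/-- Symmetry over `C`. -/
def SymmetryOver (C : SortedSet M) : Prop :=
  ∀ A B : SortedSet M, A.IsSmall κ → B.IsSmall κ → R A C B → R B C A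

/-- Extension over `C`. -/
def Language.Structure.ExtensionOver (C : SortedSet M) : Prop :=
  ∀ A B D : SortedSet M, A.IsSmall κ → B.IsSmall κ → D.IsSmall κ → R A C B →
    ∃ f : ∀ s : S, A s → M s, 𝓜.TypeEq (B ⊔ C) f A.incl ∧ R (SortedSet.range f) C (B ⊔ D)

/-- The independence theorem over `C`. The tuples `a₁`, `a₂` are arbitrary small tuples. -/
def Language.Structure.IndependenceTheoremOver (C : SortedSet M) : Prop :=
  ∀ (A₁ A₂ : SortedSet M) (I : S → Type u) (a₁ a₂ : ∀ s : S, I s → M s),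
    A₁.IsSmall κ → A₂.IsSmall κ → CardLT κ I →
    R A₁ C A₂ → R (SortedSet.range a₁) C A₁ → R (SortedSet.range a₂) C A₂ → 𝓜.TypeEq C a₁ a₂ →
    ∃ a : ∀ s : S, I s → M s,
      𝓜.TypeEq (C ⊔ A₁) a a₁ ∧ 𝓜.TypeEq (C ⊔ A₂) a a₂ ∧ R (SortedSet.range a) C (A₁ ⊔ A₂)

/-- `R` is an independence relation on the small subsets (those of size less than `κ`). -/
structure Language.Structure.IsIndependenceRelation : Prop where
  invariant : 𝓜.Invariant κ R
  normality : ∀ A B C : SortedSet M, A.IsSmall κ → B.IsSmall κ → C.IsSmall κ →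
    R A C B → R A C (B ⊔ C)
  monotonicity : ∀ C : SortedSet M, C.IsSmall κ → MonotonicityOver κ R C
  base_monotonicity : ∀ A B C D : SortedSet M, A.IsSmall κ → B.IsSmall κ → C.IsSmall κ →
    D.IsSmall κ → R A C (B ⊔ D) → R A (C ⊔ D) B
  transitivity : ∀ A B C D : SortedSet M, A.IsSmall κ → B.IsSmall κ → C.IsSmall κ →
    D.IsSmall κ → C ≤ B → B ≤ D → R A C B → R A B D → R A C D
  symmetry : ∀ C : SortedSet M, C.IsSmall κ → SymmetryOver κ R C
  full_existence : ∀ A B C : SortedSet M, A.IsSmall κ → B.IsSmall κ → C.IsSmall κ →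
    ∃ f : ∀ s : S, A s → M s, 𝓜.TypeEq C f A.incl ∧ R (SortedSet.range f) C B
  finite_character : ∀ A B C : SortedSet M, A.IsSmall κ → B.IsSmall κ → C.IsSmall κ →
    (∀ A₀ : SortedSet M, A₀ ≤ A → A₀.IsSmall Cardinal.aleph0 → R A₀ C B) → R A C B
  local_character : ∀ A : SortedSet M, A.IsSmall κ → ∃ μ : Cardinal.{u}, μ < κ ∧
    ∀ B : SortedSet M, B.IsSmall κ → ∃ C : SortedSet M, C ≤ B ∧ C.IsSmall μ ∧ R A C B

end

/-! ### Derivation-like theories and the induced relation -/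

section

variable {L₀ L : Language S} (i : L₀.Hom L) {U : S → Type u} (𝓤 : L₀.Structure U)

/-- An `L`-structure whose `L₀`-reduct is a substructure of the `L₀`-structure `𝓤`. -/
@[ext]
structure ExpansionIn where
  carrier : SortedSet U
  str : L.Structure (fun s => carrier s)
  isEmbedding : IsEmbedding (str.reduct i) 𝓤 carrier.incl

variable {i 𝓤}

/-- `A` is an `L`-substructure of `B`. -/
def ExpansionIn.IsSub (A B : ExpansionIn i 𝓤) : Prop :=
  ∃ h : A.carrier ≤ B.carrier, IsEmbedding A.str B.str fun s => Set.inclusion (h s)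

variable (i 𝓤)

/-- `T` is derivation-like with respect to the relation `R` on the small subsets of the monster
model `𝓤`. -/
def DerivationLike (κ : Cardinal.{u}) (R : TernaryRel U) (T : L.Theory) : Prop :=
  ∀ A B C : ExpansionIn i 𝓤,
    A.carrier.IsSmall κ → B.carrier.IsSmall κ → C.carrier.IsSmall κ →
    A.str.Models T.universalPart → B.str.Models T.universalPart → C.str.Models T.universalPart →
    C.IsSub A → C.IsSub B →
    𝓤.acl C.carrier ⊓ A.carrier = C.carrier → 𝓤.acl C.carrier ⊓ B.carrier = C.carrier →
    R A.carrier C.carrier B.carrier →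
    (∃ M : ExpansionIn i 𝓤, M.str.Models T ∧ A.IsSub M ∧ B.IsSub M) ∧
    ∀ M : ExpansionIn i 𝓤, M.str.Models T → A.IsSub M → B.IsSub M →
      ∀ D : SortedSet U, 𝓤.IsSubstructure D → 𝓤.closure (A.carrier ⊔ B.carrier) ≤ D →
        D ≤ 𝓤.acl (A.carrier ⊔ B.carrier) ⊓ M.carrier →
        ∃ D' : ExpansionIn i 𝓤, D'.carrier = D ∧ D'.IsSub M ∧
          ∀ E : ExpansionIn i 𝓤, E.carrier = D → E.str.Models T.universalPart →
            A.IsSub E → B.IsSub E → E = D'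

variable {i 𝓤}

/-- The universes of the `L`-structure `N`. -/
abbrev ExpansionIn.Univ (N : ExpansionIn i 𝓤) : S → Type u := fun s => N.carrier s

/-- A subset of `N`, seen as a subset of the ambient structure. -/
abbrev ExpansionIn.toAmbient (N : ExpansionIn i 𝓤) (A : SortedSet N.Univ) : SortedSet U :=
  A.image N.carrier.incl

/-- The relation on subsets of `N` induced by `R`: `A` is independent from `B` over `C` if
`acl(AC)` is `R`-independent from `acl(BC)` over `acl(C)`, where `acl` is taken in the
`L`-structure `N`. -/
def ExpansionIn.inducedRel (N : ExpansionIn i 𝓤) (R : TernaryRel U) : TernaryRel N.Univ :=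
  fun A C B =>
    R (N.toAmbient (N.str.acl (A ⊔ C))) (N.toAmbient (N.str.acl C)) (N.toAmbient (N.str.acl (B ⊔ C)))

end

end ManySorted

open ManySorted

/-!
The independence theorem passes from `R₀` in the monster model `𝓤₀` of `T₀` to the induced relation
in the monster model `Uplus` of (a completion of) the model companion `Tplus`.

Since `T₀` is model complete, every model of `T` inside `𝓤₀` is an elementary `L₀`-substructure
of `𝓤₀`. Hence `L₀`-types agree in all these models, and sets which are algebraically closed in
`Uplus` are algebraically closed in `𝓤₀`. After replacing all data by algebraic closures over `M`,
the hypotheses for the induced relation become hypotheses in `𝓤₀`: there are closed sets `E₁`, `E₂`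
and tuples `k₁`, `k₂` enumerating closed sets, conjugate over `M`. The independence theorem
in `𝓤₀`, followed by extension, gives a tuple `c` in `𝓤₀` with the `L₀`-type of `kⱼ` over `Eⱼ`, and
independent over `M` from the closure `B` of `E₁E₂`.

Give `c` the `L`-structure of `k₁` (equivalently `k₂`). By derivation-likeness over `M` there is
a model of `T`, and then a small model `Y` of `Tplus` in `𝓤₀`, containing `c` and `B` as
`L`-substructures. The uniqueness clause of derivation-likeness identifies the `L`-structure
on `acl₀(c Eⱼ)` in `Y` with the one transported from `acl₀(kⱼ Eⱼ)` in `Uplus`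
(`IsDerivationLikeSetting.sameType_over`). So no further amalgamation of the three pieces is needed.

It remains to compare `L`-types in `Y` and in `Uplus`. A common algebraically closed substructure
of two models of `Tplus` has the same type in both, provided that its `L₀`-types agree: full
existence for `R₁` makes the two models independent over it, derivation-likeness embeds both
in a model of `T`, hence in a model of `Tplus`, and `Tplus` is model complete
(`IsDerivationLikeSetting.sameType_of_isSub`, `IsDerivationLikeSetting.sameType_of_automorphism`).
Thus `B` has the same type in `Y` and in `Uplus`, and by saturation of `Uplus` the type of `c` over `B`
in `Y` is realised in `Uplus`, by a tuple `d` (`IsDerivationLikeSetting.exists_amalgam`). It contains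
the required realisation, and it is independent from `B` by invariance of `R₀`.

The model theory used is developed for the many-sorted setting: renaming of variables and the finite
support of formulas, extension of partial elementary maps in saturated structures
(`SameType.exists_extend`), downward Löwenheim–Skolem (`Language.Structure.exists_isElementarySub`),
and the description of `acl A` in a monster model as the intersection of the elementary
substructures containing `A` (`Language.Structure.IsMonster.exists_isElementarySub_notMem`), which
makes it a substructure and shows that it is algebraically closed.
-/

namespace ManySorted

variable {S : Type u}

/-! ### Renaming of variables -/

section Rename

variable {L : Language S} {V W : S → Type u}

/-- A renaming of free and bound variables, extended under one further quantifier. -/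
def liftRename {Γ Δ : List S} (ρ : ∀ t : S, V t ⊕ BVar Γ t → W t ⊕ BVar Δ t) (s : S) :
    ∀ t : S, V t ⊕ BVar (s :: Γ) t → W t ⊕ BVar (s :: Δ) t
  | _, .inl x => Sum.map id .succ (ρ _ (.inl x))
  | _, .inr .zero => .inr .zero
  | _, .inr (.succ j) => Sum.map id .succ (ρ _ (.inr j))

/-- Renaming of the variables of a term. -/
def Language.Term.rename (ρ : ∀ t : S, V t → W t) : ∀ {s : S}, L.Term V s → L.Term W s
  | _, .var x => .var (ρ _ x)
  | _, .func f ts => .func f fun j => (ts j).rename ρ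

/-- Renaming of the variables of a formula. Free variables may become bound and conversely. -/
def Language.BFormula.rename : ∀ {Γ Δ : List S}, (∀ t : S, V t ⊕ BVar Γ t → W t ⊕ BVar Δ t) →
    L.BFormula V Γ → L.BFormula W Δ
  | _, _, _, .falsum => .falsum
  | _, _, ρ, .equal t₁ t₂ => .equal (t₁.rename ρ) (t₂.rename ρ)
  | _, _, ρ, .rel R ts => .rel R fun j => (ts j).rename ρ
  | _, _, ρ, .imp φ ψ => .imp (φ.rename ρ) (ψ.rename ρ)
  | _, _, ρ, .all φ => .all (φ.rename (liftRename ρ _))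

variable {M : S → Type u} {𝓜 : L.Structure M}

theorem Language.Term.realize_rename {ρ : ∀ t : S, V t → W t} {v : ∀ s, V s → M s}
    {w : ∀ s, W s → M s} (h : ∀ t x, w t (ρ t x) = v t x) :
    ∀ {s : S} (t : L.Term V s), (t.rename ρ).realize 𝓜 w = t.realize 𝓜 v
  | _, .var x => h _ x
  | _, .func f ts => congrArg (𝓜.funMap f) (funext fun j => (ts j).realize_rename h)

theorem Language.BFormula.realize_rename : ∀ {Γ Δ : List S}
    {ρ : ∀ t : S, V t ⊕ BVar Γ t → W t ⊕ BVar Δ t} {v : ∀ s, V s → M s}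
    {xs : ∀ s, BVar Γ s → M s} {w : ∀ s, W s → M s} {ys : ∀ s, BVar Δ s → M s}
    (_ : ∀ t x, Sum.elim (w t) (ys t) (ρ t x) = Sum.elim (v t) (xs t) x)
    (φ : L.BFormula V Γ), (φ.rename ρ).Realize 𝓜 w ys ↔ φ.Realize 𝓜 v xs
  | _, _, _, _, _, _, _, _, .falsum => Iff.rfl
  | _, _, _, _, _, _, _, h, .equal t₁ t₂ => by
    simp only [rename, Realize, Term.realize_rename h]
  | _, _, _, _, _, _, _, h, .rel R ts => by
    simp only [rename, Realize, Term.realize_rename h]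
  | _, _, _, _, _, _, _, h, .imp φ ψ => imp_congr (φ.realize_rename h) (ψ.realize_rename h)
  | _, _, ρ, v, xs, w, ys, h, .all φ => by
    refine forall_congr' fun x => φ.realize_rename ?_
    have key : ∀ (t s : S) (x : M s) (y : W t ⊕ BVar _ t),
        Sum.elim (w t) (envCons x ys t) (Sum.map id .succ y) = Sum.elim (w t) (ys t) y := by
      rintro t s x (y | y) <;> rfl
    rintro t (y | y)
    · exact (key _ _ _ _).trans (h t (.inl y))
    · cases y with
      | zero => rfl
      | succ j => exact (key _ _ _ _).trans (h t (.inr j))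

/-- The formula `φ₁ → ⋯ → φₙ → ⊥`, saying that not all `φᵢ` hold. -/
def Language.BFormula.notAll {Γ : List S} (l : List (L.BFormula V Γ)) : L.BFormula V Γ :=
  l.foldr .imp .falsum

theorem Language.BFormula.realize_notAll {Γ : List S} {v : ∀ s, V s → M s}
    {xs : ∀ s, BVar Γ s → M s} (l : List (L.BFormula V Γ)) :
    (notAll l).Realize 𝓜 v xs ↔ ¬ ∀ φ ∈ l, φ.Realize 𝓜 v xs := by
  induction l with
  | nil => simp [notAll, Realize]
  | cons φ l ih =>
    have : (notAll (φ :: l)).Realize 𝓜 v xs ↔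
      (φ.Realize 𝓜 v xs → (notAll l).Realize 𝓜 v xs) := Iff.rfl
    rw [this, ih]
    simp

theorem Language.Term.realize_map {L₀ : Language S} (i : L₀.Hom L) {v : ∀ s, V s → M s} :
    ∀ {s : S} (t : L₀.Term V s), (t.map i).realize 𝓜 v = t.realize (𝓜.reduct i) v
  | _, .var _ => rfl
  | _, .func f ts =>
    congrArg (𝓜.funMap (i.onFunction f)) (funext fun j => (ts j).realize_map i)

theorem Language.BFormula.realize_map {L₀ : Language S} (i : L₀.Hom L) {v : ∀ s, V s → M s} :
    ∀ {Γ : List S} {xs : ∀ s, BVar Γ s → M s} (φ : L₀.BFormula V Γ),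
      (φ.map i).Realize 𝓜 v xs ↔ φ.Realize (𝓜.reduct i) v xs
  | _, _, .falsum => Iff.rfl
  | _, _, .equal t₁ t₂ => by simp only [map, Realize, Term.realize_map]
  | _, _, .rel R ts => by
    simp only [map, Realize, Term.realize_map]
    rfl
  | _, _, .imp φ ψ => imp_congr (φ.realize_map i) (ψ.realize_map i)
  | _, _, .all φ => forall_congr' fun _ => φ.realize_map i

end Rename

/-! ### Formulas over a subset of the variables -/

section Support

variable {L : Language S} {V : S → Type u}

/-- The free variables of `φ` can be taken from `A`, up to logical equivalence. -/
def Language.BFormula.IsOver {Γ : List S} (A : SortedSet V) (φ : L.BFormula V Γ) : Prop :=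
  ∃ φ' : L.BFormula (fun s => A s) Γ, ∀ (M : S → Type u) (𝓜 : L.Structure M)
    (v : ∀ s, V s → M s) (xs : ∀ s, BVar Γ s → M s),
    φ'.Realize 𝓜 (fun s x => v s x.1) xs ↔ φ.Realize 𝓜 v xs

/-- The free variables of the term `t` can be taken from `A`. -/
def Language.Term.IsOver {Γ : List S} {s : S} (A : SortedSet V)
    (t : L.Term (fun s => V s ⊕ BVar Γ s) s) : Prop :=
  ∃ t' : L.Term (fun s => A s ⊕ BVar Γ s) s, ∀ (M : S → Type u) (𝓜 : L.Structure M)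
    (v : ∀ s, V s → M s) (xs : ∀ s, BVar Γ s → M s),
    t'.realize 𝓜 (fun s => Sum.elim (fun x => v s x.1) (xs s)) =
      t.realize 𝓜 (fun s => Sum.elim (v s) (xs s))

/-- The renaming given by an inclusion of sets of free variables. -/
def inclRename {A B : SortedSet V} (h : A ≤ B) (Γ : List S) :
    ∀ t : S, A t ⊕ BVar Γ t → B t ⊕ BVar Γ t :=
  fun t => Sum.map (Set.inclusion (h t)) id

theorem Language.BFormula.IsOver.mono {Γ : List S} {A B : SortedSet V} (h : A ≤ B)
    {φ : L.BFormula V Γ} : φ.IsOver A → φ.IsOver B := by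
  rintro ⟨φ', hφ'⟩
  refine ⟨φ'.rename (inclRename h Γ), fun M 𝓜 v xs => ?_⟩
  rw [← hφ']
  refine realize_rename ?_ φ'
  rintro t (x | x) <;> rfl

theorem Language.Term.IsOver.mono {Γ : List S} {s : S} {A B : SortedSet V} (h : A ≤ B)
    {t : L.Term (fun s => V s ⊕ BVar Γ s) s} : t.IsOver A → t.IsOver B := by
  rintro ⟨t', ht'⟩
  refine ⟨t'.rename (inclRename h Γ), fun M 𝓜 v xs => ?_⟩
  rw [← ht']
  refine realize_rename ?_ t'
  rintro t (x | x) <;> rfl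

variable {ι : Type u} [Nonempty ι] {F : ι → SortedSet V}

theorem Language.Term.exists_isOver (hF : Directed (· ≤ ·) F) (hc : ∀ s x, ∃ j, x ∈ F j s)
    {Γ : List S} : ∀ {s : S} (t : L.Term (fun s => V s ⊕ BVar Γ s) s), ∃ j, t.IsOver (F j)
  | _, .var (.inl x) => by
    obtain ⟨j, hj⟩ := hc _ x
    exact ⟨j, .var (.inl ⟨x, hj⟩), fun M 𝓜 v xs => rfl⟩
  | _, .var (.inr x) => ⟨Classical.arbitrary ι, .var (.inr x), fun M 𝓜 v xs => rfl⟩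
  | _, .func f ts => by
    choose j hj using fun k => (ts k).exists_isOver hF hc
    obtain ⟨m, hm⟩ := hF.finite_le j
    choose t' ht' using fun k => (hj k).mono (hm k)
    exact ⟨m, .func f t', fun M 𝓜 v xs =>
      congrArg (𝓜.funMap f) (funext fun k => ht' k M 𝓜 v xs)⟩

/-- If the free variables are the union of a directed family of sets, then every formula only uses
variables from one member of the family. -/
theorem Language.BFormula.exists_isOver (hF : Directed (· ≤ ·) F)
    (hc : ∀ s x, ∃ j, x ∈ F j s) : ∀ {Γ : List S} (φ : L.BFormula V Γ), ∃ j, φ.IsOver (F j)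
  | _, .falsum => ⟨Classical.arbitrary ι, .falsum, fun M 𝓜 v xs => Iff.rfl⟩
  | _, .equal t₁ t₂ => by
    obtain ⟨j₁, h₁⟩ := t₁.exists_isOver hF hc
    obtain ⟨j₂, h₂⟩ := t₂.exists_isOver hF hc
    obtain ⟨m, hm₁, hm₂⟩ := hF j₁ j₂
    obtain ⟨u₁, hu₁⟩ := h₁.mono hm₁
    obtain ⟨u₂, hu₂⟩ := h₂.mono hm₂
    refine ⟨m, .equal u₁ u₂, fun M 𝓜 v xs => ?_⟩
    simp only [Realize, hu₁, hu₂]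
  | _, .rel R ts => by
    choose j hj using fun k => (ts k).exists_isOver hF hc
    obtain ⟨m, hm⟩ := hF.finite_le j
    choose t' ht' using fun k => (hj k).mono (hm k)
    refine ⟨m, .rel R t', fun M 𝓜 v xs => ?_⟩
    simp only [Realize, ht']
  | _, .imp φ ψ => by
    obtain ⟨j₁, h₁⟩ := φ.exists_isOver hF hc
    obtain ⟨j₂, h₂⟩ := ψ.exists_isOver hF hc
    obtain ⟨m, hm₁, hm₂⟩ := hF j₁ j₂
    obtain ⟨u₁, hu₁⟩ := h₁.mono hm₁
    obtain ⟨u₂, hu₂⟩ := h₂.mono hm₂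
    exact ⟨m, .imp u₁ u₂, fun M 𝓜 v xs => imp_congr (hu₁ M 𝓜 v xs) (hu₂ M 𝓜 v xs)⟩
  | _, .all φ => by
    obtain ⟨j, φ', h⟩ := φ.exists_isOver hF hc
    exact ⟨j, .all φ', fun M 𝓜 v xs => forall_congr' fun x => h M 𝓜 v _⟩

end Support

/-! ### Tuples of the same type -/

section SameType

variable {L : Language S} {M N P : S → Type u} {I J : S → Type u}

/-- The tuples `a` of `𝓜` and `b` of `𝓝`, with the same index set, have the same type over the
empty set. -/
def SameType (𝓜 : L.Structure M) (𝓝 : L.Structure N) (a : ∀ s, I s → M s)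
    (b : ∀ s, I s → N s) : Prop :=
  ∀ φ : L.Formula I, φ.Realize 𝓜 a envNil ↔ φ.Realize 𝓝 b envNil

variable {𝓜 : L.Structure M} {𝓝 : L.Structure N} {𝓟 : L.Structure P}
  {a : ∀ s, I s → M s} {b : ∀ s, I s → N s} {c : ∀ s, I s → P s}

theorem SameType.symm (h : SameType 𝓜 𝓝 a b) : SameType 𝓝 𝓜 b a := fun φ => (h φ).symm

theorem SameType.trans (h : SameType 𝓜 𝓝 a b) (h' : SameType 𝓝 𝓟 b c) : SameType 𝓜 𝓟 a c :=
  fun φ => (h φ).trans (h' φ)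

theorem SameType.of_imp
    (h : ∀ φ : L.Formula I, φ.Realize 𝓜 a envNil → φ.Realize 𝓝 b envNil) :
    SameType 𝓜 𝓝 a b := fun φ => ⟨h φ, fun hb => by_contra fun ha => h φ.not ha hb⟩

/-- The renaming of free variables along a map of index sets. -/
def freeRename (r : ∀ s, J s → I s) (Γ : List S) : ∀ t : S, J t ⊕ BVar Γ t → I t ⊕ BVar Γ t :=
  fun t => Sum.map (r t) id

theorem Language.BFormula.realize_freeRename (r : ∀ s, J s → I s) {Γ : List S}
    (φ : L.BFormula J Γ) (xs : ∀ s, BVar Γ s → M s) :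
    (φ.rename (freeRename r Γ)).Realize 𝓜 a xs ↔ φ.Realize 𝓜 (fun s x => a s (r s x)) xs := by
  refine realize_rename ?_ φ
  rintro t (x | x) <;> rfl

theorem SameType.comp (h : SameType 𝓜 𝓝 a b) (r : ∀ s, J s → I s) :
    SameType 𝓜 𝓝 (fun s x => a s (r s x)) (fun s x => b s (r s x)) := fun φ => by
  rw [← φ.realize_freeRename r (a := a), ← φ.realize_freeRename r (a := b)]
  exact h _

/-- A version of `SameType.comp` where the subtuples are given up to equality. -/
theorem SameType.of_comp (h : SameType 𝓜 𝓝 a b) (r : ∀ s, J s → I s) {a' : ∀ s, J s → M s}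
    {b' : ∀ s, J s → N s} (ha : ∀ s x, a s (r s x) = a' s x) (hb : ∀ s x, b s (r s x) = b' s x) :
    SameType 𝓜 𝓝 a' b' := by
  have := h.comp r
  simpa only [ha, hb] using this

theorem SameType.reduct {L₀ : Language S} (i : L₀.Hom L) (h : SameType 𝓜 𝓝 a b) :
    SameType (𝓜.reduct i) (𝓝.reduct i) a b := fun φ => by
  rw [← φ.realize_map i, ← φ.realize_map i]
  exact h _

theorem SameType.eq_iff (h : SameType 𝓜 𝓝 a b) {s : S} (x y : I s) :
    a s x = a s y ↔ b s x = b s y :=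
  h (.equal (.var (.inl x)) (.var (.inl y)))

theorem SameType.funMap_iff (h : SameType 𝓜 𝓝 a b) {w : List S} {s : S} (F : L.Functions w s)
    (x : ∀ j : Fin w.length, I (w.get j)) (y : I s) :
    a s y = 𝓜.funMap F (fun j => a _ (x j)) ↔ b s y = 𝓝.funMap F (fun j => b _ (x j)) :=
  h (.equal (.var (.inl y)) (.func F fun j => .var (.inl (x j))))

theorem SameType.relMap_iff (h : SameType 𝓜 𝓝 a b) {w : List S} (R : L.Relations w)
    (x : ∀ j : Fin w.length, I (w.get j)) :
    𝓜.relMap R (fun j => a _ (x j)) ↔ 𝓝.relMap R (fun j => b _ (x j)) :=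
  h (.rel R fun j => .var (.inl (x j)))

/-- Equality of types over `C`, restricted to a subset `D` of the parameters. -/
theorem Language.Structure.TypeEq.sameType {C D : SortedSet M} {a b : ∀ s, I s → M s} (h : 𝓜.TypeEq C a b)
    (hD : D ≤ C) : SameType 𝓜 𝓜 (fun s => Sum.elim (a s) (D.incl s))
      (fun s => Sum.elim (b s) (D.incl s)) := by
  refine SameType.of_comp h (fun s => Sum.map id (Set.inclusion (hD s))) ?_ ?_ <;>
  · rintro s (x | x) <;> rfl

theorem Language.Structure.typeEq_bot {a b : ∀ s, I s → M s} (h : SameType 𝓜 𝓜 a b) :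
    𝓜.TypeEq ⊥ a b := by
  refine SameType.of_comp h (fun s => Sum.elim id fun x => x.2.elim) ?_ ?_ <;>
  · rintro s (x | x)
    · rfl
    · exact x.2.elim

/-- An elementary map preserves types. -/
theorem IsElementary.sameType {f : ∀ s, M s → N s} (h : IsElementary 𝓜 𝓝 f)
    (a : ∀ s, I s → M s) : SameType 𝓜 𝓝 a (fun s x => f s (a s x)) :=
  SameType.comp (fun φ => (h φ).symm) a

theorem SameType.isElementary {f : ∀ s, M s → N s} (h : SameType 𝓜 𝓝 (fun _ x => x) f) :
    IsElementary 𝓜 𝓝 f := fun φ => (h φ).symm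

theorem IsElementary.isEmbedding {f : ∀ s, M s → N s} (h : IsElementary 𝓜 𝓝 f) :
    IsEmbedding 𝓜 𝓝 f where
  injective _ x y hxy := ((h.sameType fun _ x => x).eq_iff x y).2 hxy
  map_fun F x := ((h.sameType fun _ x => x).funMap_iff F x _).1 rfl
  map_rel R x := ((h.sameType fun _ x => x).relMap_iff R x).symm

theorem IsElementary.models_iff {f : ∀ s, M s → N s} (h : IsElementary 𝓜 𝓝 f) {T : L.Theory} :
    𝓜.Models T ↔ 𝓝.Models T := by
  refine forall₂_congr fun φ _ => ?_
  have := h.sameType (fun (s : S) (x : PEmpty.{u + 1}) => (nomatch x : M s)) φ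
  have e : (fun (s : S) (x : PEmpty.{u + 1}) => f s (nomatch x : M s)) = fun s x => nomatch x := by
    funext s x
    exact x.elim
  rwa [e] at this

end SameType

/-! ### Embeddings -/

section Embedding

variable {L : Language S} {M N P : S → Type u} {V : S → Type u}
  {𝓜 : L.Structure M} {𝓝 : L.Structure N} {𝓟 : L.Structure P}

theorem IsEmbedding.comp {f : ∀ s, M s → N s} {g : ∀ s, N s → P s} (hg : IsEmbedding 𝓝 𝓟 g)
    (hf : IsEmbedding 𝓜 𝓝 f) : IsEmbedding 𝓜 𝓟 (fun s x => g s (f s x)) where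
  injective s := (hg.injective s).comp (hf.injective s)
  map_fun _ x := by rw [hf.map_fun, hg.map_fun]
  map_rel _ x := by rw [hg.map_rel, hf.map_rel]

theorem IsEmbedding.reduct {L₀ : Language S} (i : L₀.Hom L) {f : ∀ s, M s → N s}
    (hf : IsEmbedding 𝓜 𝓝 f) : IsEmbedding (𝓜.reduct i) (𝓝.reduct i) f where
  injective := hf.injective
  map_fun _ x := hf.map_fun _ x
  map_rel _ x := hf.map_rel _ x

theorem IsEmbedding.congr {f g : ∀ s, M s → N s} (hf : IsEmbedding 𝓜 𝓝 f)
    (e : ∀ s x, f s x = g s x) : IsEmbedding 𝓜 𝓝 g := by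
  obtain rfl : f = g := funext fun s => funext (e s)
  exact hf

/-- If `g ∘ f` and `g` are embeddings, then so is `f`. -/
theorem IsEmbedding.of_comp {f : ∀ s, M s → N s} {g : ∀ s, N s → P s} {h : ∀ s, M s → P s}
    (hg : IsEmbedding 𝓝 𝓟 g) (hh : IsEmbedding 𝓜 𝓟 h) (e : ∀ s x, g s (f s x) = h s x) :
    IsEmbedding 𝓜 𝓝 f where
  injective s x y hxy := hh.injective s (by rw [← e, ← e, hxy])
  map_fun F x := hg.injective _ (by rw [e, hh.map_fun, hg.map_fun]; simp only [e])
  map_rel R x := by rw [← hg.map_rel, ← hh.map_rel]; simp only [e]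

theorem IsEmbedding.realize_term {f : ∀ s, M s → N s} (hf : IsEmbedding 𝓜 𝓝 f)
    (v : ∀ s, V s → M s) : ∀ {s : S} (t : L.Term V s),
      t.realize 𝓝 (fun s x => f s (v s x)) = f s (t.realize 𝓜 v)
  | _, .var _ => rfl
  | _, .func _ ts => by
    simp only [Language.Term.realize, hf.map_fun, hf.realize_term v]

theorem comp_sumElim (f : ∀ s, M s → N s) {Γ : List S} (v : ∀ s, V s → M s)
    (xs : ∀ s, BVar Γ s → M s) :
    (fun s => Sum.elim (fun x => f s (v s x)) (fun x => f s (xs s x))) =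
      fun s x => f s (Sum.elim (v s) (xs s) x) := by
  funext s x
  cases x <;> rfl

theorem comp_envCons (f : ∀ s, M s → N s) {Γ : List S} {t : S} (x : M t)
    (xs : ∀ s, BVar Γ s → M s) :
    envCons (f t x) (fun s y => f s (xs s y)) = fun s y => f s (envCons x xs s y) := by
  funext s y
  cases y <;> rfl

theorem IsEmbedding.realize_isQF {f : ∀ s, M s → N s} (hf : IsEmbedding 𝓜 𝓝 f)
    (v : ∀ s, V s → M s) {Γ : List S} (xs : ∀ s, BVar Γ s → M s) {φ : L.BFormula V Γ}
    (hφ : φ.IsQF) :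
    φ.Realize 𝓝 (fun s x => f s (v s x)) (fun s x => f s (xs s x)) ↔ φ.Realize 𝓜 v xs := by
  induction hφ with
  | falsum => rfl
  | equal t₁ t₂ =>
    simp only [Language.BFormula.Realize, comp_sumElim, hf.realize_term]
    exact (hf.injective _).eq_iff
  | rel R ts =>
    simp only [Language.BFormula.Realize, comp_sumElim, hf.realize_term]
    exact hf.map_rel R _
  | imp _ _ h₁ h₂ => exact imp_congr h₁ h₂

theorem IsEmbedding.realize_isUniversal {f : ∀ s, M s → N s} (hf : IsEmbedding 𝓜 𝓝 f)
    (v : ∀ s, V s → M s) {Γ : List S} {φ : L.BFormula V Γ} (hφ : φ.IsUniversal) :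
    ∀ xs : ∀ s, BVar Γ s → M s,
      φ.Realize 𝓝 (fun s x => f s (v s x)) (fun s x => f s (xs s x)) → φ.Realize 𝓜 v xs := by
  induction hφ with
  | of_isQF h => exact fun xs => (hf.realize_isQF v xs h).1
  | all _ ih =>
    intro xs h x
    refine ih _ ?_
    rw [← comp_envCons]
    exact h _

/-- Universal sentences pass to substructures. -/
theorem IsEmbedding.models_universalPart {f : ∀ s, M s → N s} (hf : IsEmbedding 𝓜 𝓝 f)
    {T : L.Theory} (hT : 𝓝.Models T) : 𝓜.Models T.universalPart := by
  rintro φ ⟨hφ, h⟩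
  refine hf.realize_isUniversal _ hφ envNil ?_
  have := h N 𝓝 hT φ rfl
  convert this using 1
  · funext s x
    exact x.elim
  · funext s x
    nomatch x

/-- Surjective embeddings, that is, isomorphisms, preserve all formulas. -/
theorem IsEmbedding.realize_of_surjective {f : ∀ s, M s → N s} (hf : IsEmbedding 𝓜 𝓝 f)
    (hs : ∀ s, Function.Surjective (f s)) (v : ∀ s, V s → M s) :
    ∀ {Γ : List S} (φ : L.BFormula V Γ) (xs : ∀ s, BVar Γ s → M s),
      φ.Realize 𝓝 (fun s x => f s (v s x)) (fun s x => f s (xs s x)) ↔ φ.Realize 𝓜 v xs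
  | _, .falsum, _ => Iff.rfl
  | _, .equal t₁ t₂, xs => hf.realize_isQF v xs (.equal t₁ t₂)
  | _, .rel R ts, xs => hf.realize_isQF v xs (.rel R ts)
  | _, .imp φ ψ, xs => imp_congr (hf.realize_of_surjective hs v φ xs)
      (hf.realize_of_surjective hs v ψ xs)
  | _, .all φ, xs => by
    refine (hs _).forall.trans (forall_congr' fun x => ?_)
    rw [comp_envCons]
    exact hf.realize_of_surjective hs v φ _

theorem IsEmbedding.isElementary_of_surjective {f : ∀ s, M s → N s} (hf : IsEmbedding 𝓜 𝓝 f)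
    (hs : ∀ s, Function.Surjective (f s)) : IsElementary 𝓜 𝓝 f := fun φ => by
  have := hf.realize_of_surjective hs (fun _ x => x) φ envNil
  rw [← this]
  have e : (fun (s : S) (x : BVar [] s) => f s (envNil s x)) = envNil := by
    funext s x
    nomatch x
  rw [e]

end Embedding

/-! ### Small sets -/

section Small

variable {κ : Cardinal.{u}} {V W : S → Type u} {M N : S → Type u}

theorem CardLT.of_surjective (h : CardLT κ V) (f : (Σ s, V s) → Σ s, W s)
    (hf : Function.Surjective f) : CardLT κ W :=
  (Cardinal.mk_le_of_surjective hf).trans_lt h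

theorem CardLT.of_injective (h : CardLT κ W) (f : (Σ s, V s) → Σ s, W s)
    (hf : Function.Injective f) : CardLT κ V :=
  (Cardinal.mk_le_of_injective hf).trans_lt h

theorem CardLT.mono {κ' : Cardinal.{u}} (h : CardLT κ V) (hκ : κ ≤ κ') : CardLT κ' V :=
  lt_of_lt_of_le h hκ

theorem CardLT.sum (hκ : Cardinal.aleph0 ≤ κ) (hV : CardLT κ V) (hW : CardLT κ W) :
    CardLT κ fun s => V s ⊕ W s := by
  have e : (Σ s, V s ⊕ W s) ≃ (Σ s, V s) ⊕ Σ s, W s := Equiv.sigmaSumDistrib _ _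
  rw [CardLT, Cardinal.mk_congr e, Cardinal.mk_sum, Cardinal.lift_id, Cardinal.lift_id]
  exact Cardinal.add_lt_of_lt hκ hV hW

theorem SortedSet.IsSmall.mono {A B : SortedSet M} (hB : B.IsSmall κ) (h : A ≤ B) :
    A.IsSmall κ :=
  CardLT.of_injective (V := fun s => A s) (W := fun s => B s) hB
    (Sigma.map id fun s => Set.inclusion (h s))
    (Function.injective_id.sigma_map fun s => Set.inclusion_injective (h s))

theorem SortedSet.isSmall_range {I : S → Type u} (h : CardLT κ I) (a : ∀ s, I s → M s) :
    (SortedSet.range a).IsSmall κ :=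
  CardLT.of_surjective (W := fun s => SortedSet.range a s) h
    (Sigma.map id fun s => Set.rangeFactorization (a s))
    (Function.surjective_id.sigma_map fun _ => Set.rangeFactorization_surjective (f := a _))

theorem SortedSet.image_eq_range (f : ∀ s, M s → N s) (A : SortedSet M) :
    A.image f = SortedSet.range fun s (x : A s) => f s x.1 := by
  funext s
  exact Set.image_eq_range _ _

theorem SortedSet.IsSmall.image {A : SortedSet M} (h : A.IsSmall κ) (f : ∀ s, M s → N s) :
    (A.image f).IsSmall κ := by
  rw [SortedSet.image_eq_range]
  exact SortedSet.isSmall_range h _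

theorem SortedSet.IsSmall.sup (hκ : Cardinal.aleph0 ≤ κ) {A B : SortedSet M} (hA : A.IsSmall κ)
    (hB : B.IsSmall κ) : (A ⊔ B).IsSmall κ := by
  refine CardLT.of_surjective (CardLT.sum hκ hA hB) (W := fun s => (A ⊔ B) s)
    (Sigma.map id fun s x => Sum.elim (fun y => ⟨y.1, Or.inl y.2⟩) (fun y => ⟨y.1, Or.inr y.2⟩) x) ?_
  refine Function.surjective_id.sigma_map fun s => ?_
  rintro ⟨x, hx | hx⟩
  · exact ⟨.inl ⟨x, hx⟩, rfl⟩
  · exact ⟨.inr ⟨x, hx⟩, rfl⟩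

end Small

/-! ### Saturation for tuples -/

section Saturation

variable {L : Language S} {Q U : S → Type u} {𝓠 : L.Structure Q} {𝓤 : L.Structure U}
  {κ : Cardinal.{u}} {I J : S → Type u}

/-- Saturation, with the parameters given as a tuple. -/
theorem Language.Structure.IsSaturated.exists_realize (h : 𝓤.IsSaturated κ) (hI : CardLT κ I)
    (b : ∀ s, I s → U s) {s : S} (P : Set (L.BFormula I [s]))
    (hP : ∀ q : Finset (L.BFormula I [s]), ↑q ⊆ P →
      ∃ x : U s, ∀ φ ∈ q, φ.Realize 𝓤 b (envCons x envNil)) :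
    ∃ x : U s, ∀ φ ∈ P, φ.Realize 𝓤 b (envCons x envNil) := by
  classical
  let r : ∀ s, I s → SortedSet.range b s := fun s j => ⟨b s j, j, rfl⟩
  have key : ∀ (φ : L.BFormula I [s]) (x : U s),
      x ∈ 𝓤.solutions (SortedSet.range b) (φ.rename (freeRename r [s])) ↔
        φ.Realize 𝓤 b (envCons x envNil) := fun φ x => φ.realize_freeRename r _
  obtain ⟨x, hx⟩ := h (SortedSet.range b) (SortedSet.isSmall_range hI b) s
    ((fun φ => φ.rename (freeRename r [s])) '' P) (by
      intro q hq
      obtain ⟨q', hq', rfl⟩ := Finset.subset_set_image_iff.1 hq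
      obtain ⟨x, hx⟩ := hP q' hq'
      refine ⟨x, fun φ hφ => ?_⟩
      obtain ⟨ψ, hψ, rfl⟩ := Finset.mem_image.1 hφ
      exact (key ψ x).2 (hx ψ hψ))
  exact ⟨x, fun φ hφ => (key φ x).1 (hx _ ⟨φ, hφ, rfl⟩)⟩

/-- The renaming that turns the single extra free variable, indexed by `BVar [s]`, into a bound
variable. -/
def bindRename (I : S → Type u) (s : S) :
    ∀ t, (I t ⊕ BVar [s] t) ⊕ BVar [] t → I t ⊕ BVar [s] t
  | _, .inl x => x

theorem realize_bindRename (a : ∀ s, I s → Q s) {s : S} (x : Q s)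
    (φ : L.Formula fun t => I t ⊕ BVar [s] t) :
    (φ.rename (bindRename I s)).Realize 𝓠 a (envCons x envNil) ↔
      φ.Realize 𝓠 (fun t => Sum.elim (a t) (envCons x envNil t)) envNil := by
  refine Language.BFormula.realize_rename ?_ φ
  rintro t (y | y)
  · rfl
  · nomatch y

/-- The one-variable step in extending a partial elementary map. -/
theorem SameType.exists_extend_one (h : 𝓤.IsSaturated κ) (hI : CardLT κ I)
    {a : ∀ s, I s → Q s} {b : ∀ s, I s → U s} (hab : SameType 𝓠 𝓤 a b) {s : S} (x : Q s) :
    ∃ y : U s, SameType 𝓠 𝓤 (fun t => Sum.elim (a t) (envCons x envNil t))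
      (fun t => Sum.elim (b t) (envCons y envNil t)) := by
  obtain ⟨y, hy⟩ := h.exists_realize hI b
    {φ : L.BFormula I [s] | φ.Realize 𝓠 a (envCons x envNil)} (by
      intro q hq
      -- Otherwise `b` satisfies `∀ x, ¬ ⋀ q`, hence so does `a`, contradicting the choice of `x`.
      by_contra! hne
      have h₁ : (Language.BFormula.all (.notAll q.toList) : L.Formula I).Realize 𝓤 b envNil := by
        intro y
        rw [Language.BFormula.realize_notAll]
        obtain ⟨φ, hφ, hn⟩ := hne y
        exact fun h => hn (h φ (Finset.mem_toList.2 hφ))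
      have h₂ := (hab _).2 h₁ x
      rw [Language.BFormula.realize_notAll] at h₂
      exact h₂ fun φ hφ => hq (Finset.mem_toList.1 hφ))
  refine ⟨y, SameType.of_imp fun φ hφ => ?_⟩
  rw [← realize_bindRename] at hφ ⊢
  exact hy _ hφ

/-- In a saturated structure, a partial elementary map defined on a small set can be extended to
any small set. -/
theorem SameType.exists_extend (hκ : Cardinal.aleph0 ≤ κ) (h : 𝓤.IsSaturated κ)
    (hI : CardLT κ I) (hJ : CardLT κ J) {a : ∀ s, I s → Q s} {b : ∀ s, I s → U s}
    (hab : SameType 𝓠 𝓤 a b) (c : ∀ s, J s → Q s) :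
    ∃ d : ∀ s, J s → U s, SameType 𝓠 𝓤 (fun s => Sum.elim (a s) (c s))
      (fun s => Sum.elim (b s) (d s)) := by
  classical
  -- The graphs of partial elementary maps defined on a subset of the entries of `a` and `c`.
  let D : SortedSet Q := SortedSet.range fun s => Sum.elim (a s) (c s)
  have hD : D.IsSmall κ := SortedSet.isSmall_range (CardLT.sum hκ hI hJ) _
  let E : Set (SortedSet fun s => Q s × U s) := {G | (∀ s, ∀ p ∈ G s, p.1 ∈ D s) ∧
    SameType 𝓠 𝓤 (fun s (p : G s) => p.1.1) (fun s (p : G s) => p.1.2)}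
  let G₀ : SortedSet fun s => Q s × U s := SortedSet.range fun s j => (a s j, b s j)
  have hG₀ : G₀ ∈ E := by
    constructor
    · rintro s _ ⟨j, rfl⟩
      exact ⟨.inl j, rfl⟩
    · refine hab.of_comp (fun s p => p.2.choose) ?_ ?_
      · exact fun s p => congrArg Prod.fst p.2.choose_spec
      · exact fun s p => congrArg Prod.snd p.2.choose_spec
  obtain ⟨G, hG₀G, hG⟩ := zorn_le_nonempty₀ E (by
    intro C hCE hC G' hG'
    refine ⟨fun s => ⋃ F : C, F.1 s, ⟨?_, fun φ => ?_⟩, fun F hF s => ?_⟩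
    · intro s p hp
      obtain ⟨F, hF⟩ := Set.mem_iUnion.1 hp
      exact (hCE F.2).1 s p hF
    · -- A formula only mentions pairs from one member of the chain.
      have : Nonempty C := ⟨⟨G', hG'⟩⟩
      obtain ⟨F, φ', hφ'⟩ := φ.exists_isOver
        (F := fun (F : C) (s : S) => {p : ↥(⋃ F : C, F.1 s) | p.1 ∈ F.1 s}) (by
          intro F₁ F₂
          rcases hC.total F₁.2 F₂.2 with h | h
          · exact ⟨F₂, fun s p hp => h s hp, le_rfl⟩
          · exact ⟨F₁, le_rfl, fun s p hp => h s hp⟩) (by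
          rintro s ⟨p, hp⟩
          exact (Set.mem_iUnion (s := fun F : C => F.1 s)).1 hp)
      rw [← hφ', ← hφ']
      exact (hCE F.2).2.comp (fun s p => ⟨p.1.1, p.2⟩) φ'
    · exact Set.subset_iUnion (fun F : C => F.1 s) ⟨F, hF⟩) G₀ hG₀
  have hGE : G ∈ E := hG.prop
  -- Elementary relations are functional, so `G` is no larger than its domain.
  have hsmall : CardLT κ fun s => G s := by
    refine CardLT.of_injective hD (Sigma.map id fun s p => ⟨p.1.1, hGE.1 s _ p.2⟩)
      (Function.injective_id.sigma_map fun s p q hpq => ?_)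
    have h₁ : p.1.1 = q.1.1 := congrArg Subtype.val hpq
    exact Subtype.ext (Prod.ext h₁ ((hGE.2.eq_iff p q).1 h₁))
  -- By maximality and the one-variable step, `G` is defined on all of `D`.
  have htotal : ∀ s, ∀ x ∈ D s, ∃ y, (x, y) ∈ G s := by
    intro s x hx
    obtain ⟨y, hy⟩ := hGE.2.exists_extend_one h hsmall x
    let H : SortedSet fun s => Q s × U s := SortedSet.range fun t =>
      Sum.elim (fun p : G t => p.1) fun z : BVar [s] t => (envCons x envNil t z, envCons y envNil t z)
    have hGH : G ≤ H := fun t p hp => ⟨.inl ⟨p, hp⟩, rfl⟩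
    have hH : H ∈ E := by
      constructor
      · rintro t _ ⟨p | z, rfl⟩
        · exact hGE.1 t _ p.2
        · cases z with
          | zero => exact hx
          | succ z => nomatch z
      · refine hy.of_comp (fun s p => p.2.choose) ?_ ?_
        · intro t p
          refine Eq.trans ?_ (congrArg Prod.fst p.2.choose_spec)
          cases p.2.choose <;> rfl
        · intro t p
          refine Eq.trans ?_ (congrArg Prod.snd p.2.choose_spec)
          cases p.2.choose <;> rfl
    exact ⟨y, hG.le_of_ge hH hGH s ⟨.inr .zero, rfl⟩⟩
  choose d hd using fun s (j : J s) => htotal s (c s j) ⟨.inr j, rfl⟩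
  refine ⟨d, hGE.2.of_comp (fun s => Sum.elim (fun j => ⟨(a s j, b s j), hG₀G s ⟨j, rfl⟩⟩)
    fun j => ⟨(c s j, d s j), hd s j⟩) ?_ ?_⟩
  · rintro s (j | j) <;> rfl
  · rintro s (j | j) <;> rfl

end Saturation

/-! ### The number of formulas -/

section Counting

open Cardinal

theorem mk_sigma_le {lam : Cardinal.{u}} (hlam : ℵ₀ ≤ lam) {α : Type u} {β : α → Type u}
    (hα : #α ≤ lam) (hβ : ∀ a, #(β a) ≤ lam) : #(Σ a, β a) ≤ lam := by
  rw [mk_sigma]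
  refine (sum_le_mk_mul_iSup _).trans ?_
  exact (mul_le_mul' hα (ciSup_le' hβ)).trans (mul_eq_self hlam).le

theorem mk_sum_le {lam : Cardinal.{u}} (hlam : ℵ₀ ≤ lam) {α β : Type u}
    (hα : #α ≤ lam) (hβ : #β ≤ lam) : #(α ⊕ β) ≤ lam := by
  rw [mk_sum, lift_id, lift_id]
  exact (add_le_add hα hβ).trans (add_eq_self hlam).le

theorem mk_list_le {lam : Cardinal.{u}} (hlam : ℵ₀ ≤ lam) {α : Type u}
    (hα : #α ≤ lam) : #(List α) ≤ lam :=
  (mk_list_le_max α).trans (max_le hlam hα)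

theorem finite_bVar : ∀ Γ : List S, Finite (Σ s, BVar Γ s)
  | [] => by
    have : IsEmpty (Σ s, BVar ([] : List S) s) := ⟨fun x => nomatch x.2⟩
    infer_instance
  | t :: Γ => by
    have := finite_bVar Γ
    refine Finite.of_surjective (α := Option (Σ s, BVar Γ s))
      (fun x => x.elim ⟨t, .zero⟩ fun y => ⟨y.1, .succ y.2⟩) ?_
    rintro ⟨s, x⟩
    cases x with
    | zero => exact ⟨none, rfl⟩
    | succ x => exact ⟨some ⟨_, x⟩, rfl⟩

variable {L : Language S} {V : S → Type u} {lam : Cardinal.{u}}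

open scoped Classical in
/-- Decoding of well-founded trees into terms; every term has a code. -/
noncomputable def Language.Term.decode :
    WType (fun x : (Σ s, V s) ⊕ (Σ w : List S, Σ s, L.Functions w s) =>
      Sum.elim (fun _ => PEmpty.{u + 1}) (fun f => ULift.{u} (Fin f.1.length)) x) →
    Option (Σ s, L.Term V s)
  | ⟨.inl x, _⟩ => some ⟨x.1, .var x.2⟩
  | ⟨.inr f, ts⟩ =>
    if h : ∀ j, ∃ t, decode (ts ⟨j⟩) = some ⟨f.1.get j, t⟩ then
      some ⟨f.2.1, .func f.2.2 fun j => (h j).choose⟩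
    else none

theorem Language.Term.exists_decode : ∀ {s : S} (t : L.Term V s), ∃ x, decode x = some ⟨s, t⟩
  | s, .var x => ⟨⟨.inl ⟨s, x⟩, fun y => y.elim⟩, by simp [decode]⟩
  | s, .func (w := w) f ts => by
    choose x hx using fun j => (ts j).exists_decode
    refine ⟨⟨.inr ⟨w, s, f⟩, fun j => x j.down⟩, ?_⟩
    have h : ∀ j, ∃ t, decode (x j) = some ⟨w.get j, t⟩ := fun j => ⟨_, hx j⟩
    have e : ∀ j, (h j).choose = ts j := fun j => by
      have := (hx j).symm.trans (h j).choose_spec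
      simpa using this.symm
    rw [decode, dif_pos h]
    simp only [e]

theorem mk_funSym_le (hL : L.card ≤ lam) :
    #(Σ w : List S, Σ s, L.Functions w s) ≤ lam :=
  (self_le_add_left _ _).trans ((self_le_add_right _ _).trans hL)

theorem mk_relSym_le (hL : L.card ≤ lam) : #(Σ w : List S, L.Relations w) ≤ lam :=
  (self_le_add_left _ _).trans hL

theorem mk_sorts_le (hL : L.card ≤ lam) : #S ≤ lam :=
  (self_le_add_right _ _).trans ((self_le_add_right _ _).trans hL)

theorem Language.Term.mk_le (hlam : ℵ₀ ≤ lam) (hL : L.card ≤ lam) (hV : #(Σ s, V s) ≤ lam) :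
    #(Σ s, L.Term V s) ≤ lam := by
  choose code hcode using fun x : Σ s, L.Term V s => x.2.exists_decode
  have hinj : Function.Injective code := fun x y hxy => by
    have := (hcode x).symm.trans ((congrArg _ hxy).trans (hcode y))
    simpa using this
  refine (mk_le_of_injective hinj).trans ?_
  have (x : (Σ s, V s) ⊕ (Σ w : List S, Σ s, L.Functions w s)) : Finite
      (Sum.elim (fun _ => PEmpty.{u + 1}) (fun f => ULift.{u} (Fin f.1.length)) x) := by
    rcases x with x | x
    · exact inferInstanceAs (Finite PEmpty)
    · exact inferInstanceAs (Finite (ULift _))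
  exact WType.cardinalMk_le_max_aleph0_of_finite.trans
    (max_le (mk_sum_le hlam hV (mk_funSym_le hL)) hlam)

variable (L V) in
/-- The data of an atomic formula. -/
def AtomData (Γ : List S) : Type u :=
  PUnit.{u + 1} ⊕ (Σ s, L.Term (fun s => V s ⊕ BVar Γ s) s × L.Term (fun s => V s ⊕ BVar Γ s) s) ⊕
    Σ w : List S, L.Relations w × ∀ i : Fin w.length, L.Term (fun s => V s ⊕ BVar Γ s) (w.get i)

theorem AtomData.mk_le (hlam : ℵ₀ ≤ lam) (hL : L.card ≤ lam) (hV : #(Σ s, V s) ≤ lam)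
    (Γ : List S) : #(AtomData L V Γ) ≤ lam := by
  have hS : #S ≤ lam := mk_sorts_le hL
  have h1 : 1 ≤ lam := one_le_aleph0.trans hlam
  have hVΓ : #(Σ s, V s ⊕ BVar Γ s) ≤ lam := by
    rw [mk_congr (Equiv.sigmaSumDistrib _ _)]
    have := finite_bVar Γ
    exact mk_sum_le hlam hV ((lt_aleph0_of_finite _).le.trans hlam)
  have hT := Language.Term.mk_le hlam hL hVΓ
  have hT' (s : S) : #(L.Term (fun s => V s ⊕ BVar Γ s) s) ≤ lam :=
    (mk_le_of_injective (sigma_mk_injective (i := s))).trans hT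
  have hprod {α β : Type u} (hα : #α ≤ lam) (hβ : #β ≤ lam) : #(α × β) ≤ lam := by
    rw [mk_prod, lift_id, lift_id]
    exact (mul_le_mul' hα hβ).trans (mul_eq_self hlam).le
  refine mk_sum_le hlam (mk_punit.trans_le h1) (mk_sum_le hlam (mk_sigma_le hlam hS fun s =>
    hprod (hT' s) (hT' s)) (mk_sigma_le hlam (mk_list_le hlam hS) fun w => hprod ?_ ?_))
  · exact (mk_le_of_injective (sigma_mk_injective (i := w))).trans (mk_relSym_le hL)
  · let code (ts : ∀ i : Fin w.length, L.Term (fun s => V s ⊕ BVar Γ s) (w.get i))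
        (i : Fin w.length) : Σ s, L.Term (fun s => V s ⊕ BVar Γ s) s := ⟨_, ts i⟩
    have hcode : Function.Injective code := fun ts ts' h => by
      funext j
      simpa [code] using congrFun h j
    refine (mk_le_of_injective hcode).trans ?_
    rw [mk_arrow, lift_uzero, mk_fin, lift_natCast, power_natCast]
    exact (power_le_power_right hT).trans (power_nat_le hlam)

variable (L V) in
/-- The arities in the trees coding formulas: atomic formulas are leaves, implications (`false`)
have two children and universal quantifiers (`true`) have one. -/
def formulaArity : (Σ Γ, AtomData L V Γ) ⊕ Bool → Type
  | .inl _ => Empty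
  | .inr false => Bool
  | .inr true => Unit

open scoped Classical in
/-- Decoding of well-founded trees into formulas; every formula has a code. -/
noncomputable def Language.BFormula.decode :
    WType (formulaArity L V) → Option (Σ Γ, L.BFormula V Γ)
  | ⟨.inl ⟨Γ, .inl _⟩, _⟩ => some ⟨Γ, .falsum⟩
  | ⟨.inl ⟨Γ, .inr (.inl x)⟩, _⟩ => some ⟨Γ, .equal x.2.1 x.2.2⟩
  | ⟨.inl ⟨Γ, .inr (.inr x)⟩, _⟩ => some ⟨Γ, .rel x.2.1 x.2.2⟩
  | ⟨.inr false, f⟩ =>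
    match decode (f false), decode (f true) with
    | some ⟨Γ, φ⟩, some ⟨Δ, ψ⟩ => if h : Δ = Γ then some ⟨Γ, φ.imp (h ▸ ψ)⟩ else none
    | _, _ => none
  | ⟨.inr true, f⟩ =>
    match decode (f ()) with
    | some ⟨_ :: Γ, φ⟩ => some ⟨Γ, φ.all⟩
    | _ => none

theorem Language.BFormula.exists_decode :
    ∀ {Γ : List S} (φ : L.BFormula V Γ), ∃ x, decode x = some ⟨Γ, φ⟩
  | Γ, .falsum => ⟨⟨.inl ⟨Γ, .inl ⟨⟩⟩, Empty.elim⟩, by simp [decode]⟩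
  | Γ, .equal (s := s) t₁ t₂ => ⟨⟨.inl ⟨Γ, .inr (.inl ⟨s, t₁, t₂⟩)⟩, Empty.elim⟩, by simp [decode]⟩
  | Γ, .rel (w := w) R ts => ⟨⟨.inl ⟨Γ, .inr (.inr ⟨w, R, ts⟩)⟩, Empty.elim⟩, by simp [decode]⟩
  | Γ, .imp φ ψ => by
    obtain ⟨x, hx⟩ := φ.exists_decode
    obtain ⟨y, hy⟩ := ψ.exists_decode
    exact ⟨⟨.inr false, fun b : Bool => if b then y else x⟩, by simp [decode, hx, hy]⟩
  | Γ, .all φ => by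
    obtain ⟨x, hx⟩ := φ.exists_decode
    exact ⟨⟨.inr true, fun _ => x⟩, by simp [decode, hx]⟩

/-- There are at most `lam` formulas if `lam` is infinite and bounds the size of the language and
the number of variables. -/
theorem Language.BFormula.mk_le (hlam : ℵ₀ ≤ lam) (hL : L.card ≤ lam) (hV : #(Σ s, V s) ≤ lam)
    (Γ : List S) : #(L.BFormula V Γ) ≤ lam := by
  choose code hcode using fun φ : L.BFormula V Γ => φ.exists_decode
  have hinj : Function.Injective code := fun x y hxy => by
    have := (hcode x).symm.trans ((congrArg _ hxy).trans (hcode y))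
    simpa using this
  refine (mk_le_of_injective hinj).trans ?_
  have (x : (Σ Γ, AtomData L V Γ) ⊕ Bool) : Finite (formulaArity L V x) := by
    rcases x with x | x | x
    · exact inferInstanceAs (Finite Empty)
    · exact inferInstanceAs (Finite Bool)
    · exact inferInstanceAs (Finite Unit)
  refine WType.cardinalMk_le_max_aleph0_of_finite'.trans (max_le ?_ hlam)
  rw [lift_uzero, mk_sum, lift_uzero]
  have hS : #S ≤ lam := mk_sorts_le hL
  exact (add_le_add (mk_sigma_le hlam (mk_list_le hlam hS) fun Γ => AtomData.mk_le hlam hL hV Γ)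
    ((lift_lt_aleph0.2 (lt_aleph0_of_finite Bool)).le.trans hlam)).trans (add_eq_self hlam).le

end Counting

/-! ### Elementary substructures -/

section Elementary

variable {L : Language S} {M : S → Type u} (𝓜 : L.Structure M) {κ : Cardinal.{u}}

/-- `A` is the universe of an elementary substructure. -/
def Language.Structure.IsElementarySub (A : SortedSet M) : Prop :=
  ∃ 𝓐 : L.Structure (fun s => A s), IsElementary 𝓐 𝓜 A.incl

/-- The Tarski–Vaught condition. -/
def Language.Structure.TarskiVaught (A : SortedSet M) : Prop :=
  ∀ (s : S) (φ : L.BFormula (fun s => A s) [s]), (𝓜.solutions A φ).Nonempty →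
    ∃ x : A s, x.1 ∈ 𝓜.solutions A φ

variable {𝓜}

theorem Language.Structure.TarskiVaught.isElementarySub {A : SortedSet M}
    (h : 𝓜.TarskiVaught A) : 𝓜.IsElementarySub A := by
  have hfun {w : List S} {s : S} (F : L.Functions w s) (x : ∀ j : Fin w.length, A (w.get j)) :
      ∃ y : A s, y.1 = 𝓜.funMap F fun j => (x j).1 :=
    h s (.equal (.var (.inr .zero)) (.func F fun j => .var (.inl (x j))))
      ⟨𝓜.funMap F fun j => (x j).1, by exact rfl⟩
  choose g hg using @hfun
  let 𝓐 : L.Structure fun s => A s :=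
    { nonempty := fun s => by
        obtain ⟨z⟩ := 𝓜.nonempty s
        exact (h s (.equal (.var (.inr .zero)) (.var (.inr .zero))) ⟨z, rfl⟩).nonempty
      funMap := g
      relMap := fun R x => 𝓜.relMap R fun j => (x j).1 }
  have hA : IsEmbedding 𝓐 𝓜 A.incl :=
    ⟨fun s => Subtype.val_injective, fun F x => hg F x, fun R x => Iff.rfl⟩
  refine ⟨𝓐, ?_⟩
  have key : ∀ {Γ : List S} (φ : L.BFormula (fun s => A s) Γ) (xs : ∀ s, BVar Γ s → A s),
      φ.Realize 𝓜 A.incl (fun s x => (xs s x).1) ↔ φ.Realize 𝓐 (fun _ x => x) xs := by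
    intro Γ φ
    induction φ with
    | falsum => exact fun xs => Iff.rfl
    | equal t₁ t₂ => exact fun xs => hA.realize_isQF (fun _ x => x) xs (.equal t₁ t₂)
    | rel R ts => exact fun xs => hA.realize_isQF (fun _ x => x) xs (.rel R ts)
    | imp φ ψ h₁ h₂ => exact fun xs => imp_congr (h₁ xs) (h₂ xs)
    | @all Γ s φ ih =>
      intro xs
      constructor
      · intro hφ x
        rw [← ih, ← comp_envCons (fun s (x : A s) => x.1)]
        exact hφ x.1
      · intro hφ x
        by_contra hx
        -- Make the bound variables other than the last one into parameters.
        let ρ : ∀ t, A t ⊕ BVar (s :: Γ) t → A t ⊕ BVar [s] t := fun t y => match t, y with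
          | _, .inl a => .inl a
          | _, .inr .zero => .inr .zero
          | _, .inr (.succ j) => .inl (xs _ j)
        have hρ (z : M s) : (φ.rename ρ).Realize 𝓜 A.incl (envCons z envNil) ↔
            φ.Realize 𝓜 A.incl (envCons z fun s x => (xs s x).1) := by
          refine Language.BFormula.realize_rename ?_ φ
          rintro t (y | y)
          · rfl
          · cases y <;> rfl
        obtain ⟨y, hy⟩ := h s (φ.rename ρ).not ⟨x, fun h => hx ((hρ x).1 h)⟩
        refine hy ((hρ y.1).2 ?_)
        have := (ih _).2 (hφ y)
        rwa [← comp_envCons (fun s (x : A s) => x.1)] at this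
  intro φ
  rw [← key φ envNil]
  have e : (fun (s : S) (x : BVar [] s) => (envNil (M := fun s => A s) s x).1) = envNil := by
    funext s x
    nomatch x
  rw [e]

/-- The downward Löwenheim–Skolem theorem. -/
theorem Language.Structure.exists_isElementarySub (hκ : Cardinal.aleph0 < κ) (hL : L.card < κ)
    {A : SortedSet M} (hA : A.IsSmall κ) :
    ∃ B : SortedSet M, A ≤ B ∧ B.IsSmall κ ∧ 𝓜.IsElementarySub B := by
  classical
  let lam := max (max Cardinal.aleph0 L.card) (Cardinal.mk (Σ s, A s))
  have hlam : Cardinal.aleph0 ≤ lam := (le_max_left _ _).trans (le_max_left _ _)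
  have hLlam : L.card ≤ lam := (le_max_right _ _).trans (le_max_left _ _)
  have hlt : lam < κ := max_lt (max_lt hκ hL) hA
  have wit (C : SortedSet M) (s : S) (φ : L.BFormula (fun s => C s) [s]) :
      ∃ x : M s, (𝓜.solutions C φ).Nonempty → x ∈ 𝓜.solutions C φ := by
    obtain ⟨z⟩ := 𝓜.nonempty s
    by_cases h : (𝓜.solutions C φ).Nonempty
    · exact ⟨h.some, fun _ => h.some_mem⟩
    · exact ⟨z, fun h' => (h h').elim⟩
  choose w hw using wit
  -- Add witnesses for all formulas with parameters, and iterate `ω` times.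
  let step (C : SortedSet M) : SortedSet M := fun s => C s ∪ Set.range (w C s)
  let N (n : ℕ) : SortedSet M := step^[n] A
  have hN (n : ℕ) : N (n + 1) = step (N n) := Function.iterate_succ_apply' _ _ _
  have hmono : Monotone N := monotone_nat_of_le_succ fun n s x hx => by
    rw [hN]
    exact Or.inl hx
  have hcard (n : ℕ) : Cardinal.mk (Σ s, N n s) ≤ lam := by
    induction n with
    | zero => exact le_max_right _ _
    | succ n ih =>
      rw [hN]
      refine mk_sigma_le hlam (mk_sorts_le hLlam) fun s => (Cardinal.mk_union_le _ _).trans ?_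
      refine (add_le_add ((Cardinal.mk_le_of_injective (sigma_mk_injective (i := s))).trans ih)
        (Cardinal.mk_range_le.trans (Language.BFormula.mk_le hlam hLlam ih _))).trans ?_
      exact (Cardinal.add_eq_self hlam).le
  refine ⟨fun s => ⋃ n : ULift.{u} ℕ, N n.down s, ?_, ?_, ?_⟩
  · exact fun s x hx => Set.mem_iUnion.2 ⟨⟨0⟩, hx⟩
  · refine lt_of_le_of_lt (mk_sigma_le hlam (mk_sorts_le hLlam) fun s => ?_) hlt
    refine (Cardinal.mk_iUnion_le _).trans ?_
    refine (mul_le_mul' (Cardinal.mk_le_aleph0.trans hlam) (ciSup_le' fun n : ULift.{u} ℕ =>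
      (Cardinal.mk_le_of_injective (sigma_mk_injective (i := s))).trans (hcard n.down))).trans ?_
    exact (Cardinal.mul_eq_self hlam).le
  · -- The parameters of a formula all occur at some stage `n`, so it has a witness at `n + 1`.
    refine Language.Structure.TarskiVaught.isElementarySub fun s φ hφ => ?_
    obtain ⟨n, φ', hφ'⟩ := φ.exists_isOver
      (F := fun (n : ULift.{u} ℕ) (s : S) => {p : ↥(⋃ n : ULift.{u} ℕ, N n.down s) | p.1 ∈ N n.down s})
      (directed_of_isDirected_le fun m n hmn s p hp => hmono hmn s hp) (by
        rintro s ⟨p, hp⟩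
        exact (Set.mem_iUnion (s := fun n : ULift.{u} ℕ => N n.down s)).1 hp)
    let ψ : L.BFormula (fun s => N n.down s) [s] := φ'.rename
      (freeRename (fun s p => ⟨p.1.1, p.2⟩) [s])
    have hψ (x : M s) : x ∈ 𝓜.solutions (N n.down) ψ ↔ x ∈ 𝓜.solutions _ φ :=
      (φ'.realize_freeRename _ _).trans (hφ' M 𝓜 (fun _ x => x.1) _)
    have hx := (hψ _).1 (hw (N n.down) s ψ (hφ.imp fun x => (hψ x).2))
    refine ⟨⟨w (N n.down) s ψ, Set.mem_iUnion.2 ⟨⟨n.down + 1⟩, ?_⟩⟩, hx⟩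
    rw [hN]
    exact Or.inr ⟨ψ, rfl⟩

end Elementary

/-! ### Transport of structure to the range of an injective map -/

section OnRange

variable {L : Language S} {Q M : S → Type u}

/-- The structure on the range of an injective map `h` which makes `h` an isomorphism onto its
range. (Preimages are chosen, so this is meaningless if `h` is not injective.) -/
noncomputable def Language.Structure.onRange (𝓠 : L.Structure Q) (h : ∀ s, Q s → M s) :
    L.Structure fun s => SortedSet.range h s where
  nonempty s := (𝓠.nonempty s).map fun x => ⟨h s x, x, rfl⟩
  funMap F x := ⟨h _ (𝓠.funMap F fun j => (x j).2.choose), _, rfl⟩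
  relMap R x := 𝓠.relMap R fun j => (x j).2.choose

/-- A map, with codomain restricted to its range. -/
def toRange (h : ∀ s, Q s → M s) : ∀ s, Q s → SortedSet.range h s := fun s x => ⟨h s x, x, rfl⟩

theorem toRange_surjective (h : ∀ s, Q s → M s) (s : S) : Function.Surjective (toRange h s) := by
  rintro ⟨_, x, rfl⟩
  exact ⟨x, rfl⟩

theorem isEmbedding_toRange (𝓠 : L.Structure Q) {h : ∀ s, Q s → M s}
    (hh : ∀ s, Function.Injective (h s)) : IsEmbedding 𝓠 (𝓠.onRange h) (toRange h) := by
  have e : ∀ s (x : Q s), (toRange h s x).2.choose = x := fun s x =>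
    hh s (toRange h s x).2.choose_spec
  refine ⟨fun s x y hxy => hh s (congrArg Subtype.val hxy), fun F x => Subtype.ext ?_,
    fun R x => ?_⟩
  · have e' : (fun j => (toRange h _ (x j)).2.choose) = x := funext fun j => e _ _
    exact congrArg (fun z => h _ (𝓠.funMap F z)) e'.symm
  · simp only [Language.Structure.onRange, e]

theorem isElementary_toRange (𝓠 : L.Structure Q) {h : ∀ s, Q s → M s}
    (hh : ∀ s, Function.Injective (h s)) : IsElementary 𝓠 (𝓠.onRange h) (toRange h) :=
  (isEmbedding_toRange 𝓠 hh).isElementary_of_surjective (toRange_surjective h)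

variable {𝓠 : L.Structure Q} {𝓜 : L.Structure M}

theorem IsEmbedding.incl_range {h : ∀ s, Q s → M s} (hh : IsEmbedding 𝓠 𝓜 h) :
    IsEmbedding (𝓠.onRange h) 𝓜 (SortedSet.range h).incl where
  injective s := Subtype.val_injective
  map_fun F x := by
    refine (hh.map_fun F _).trans (congrArg _ (funext fun j => ?_))
    exact (x j).2.choose_spec
  map_rel R x := by
    refine Iff.trans ?_ (hh.map_rel R _)
    have e : (fun j => (SortedSet.range h).incl _ (x j)) = fun j => h _ (x j).2.choose :=
      funext fun j => (x j).2.choose_spec.symm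
    rw [e]

theorem IsElementary.isElementarySub_range {h : ∀ s, Q s → M s} (hh : IsElementary 𝓠 𝓜 h) :
    𝓜.IsElementarySub (SortedSet.range h) := by
  have hi := isElementary_toRange 𝓠 hh.isEmbedding.injective
  refine ⟨𝓠.onRange h, SameType.isElementary ?_⟩
  refine ((hi.sameType fun s x => x.2.choose).symm.trans
    (hh.sameType fun s (x : SortedSet.range h s) => x.2.choose)).of_comp (fun _ x => x) ?_ ?_
  · exact fun s x => Subtype.ext x.2.choose_spec
  · exact fun s x => x.2.choose_spec

end OnRange

/-! ### Algebraic closure -/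

section Acl

variable {L : Language S} {M N : S → Type u} {𝓜 : L.Structure M} {𝓝 : L.Structure N}
  {I : S → Type u} {κ : Cardinal.{u}}

/-- The realisations of a formula in one variable whose parameters are given as a tuple. -/
def Language.Structure.sol (𝓜 : L.Structure M) (a : ∀ s, I s → M s) {s : S}
    (φ : L.BFormula I [s]) : Set (M s) :=
  {x | φ.Realize 𝓜 a (envCons x envNil)}

/-- The parameters in the definition of algebraic closure may be given as a tuple. -/
theorem Language.Structure.mem_acl_range {a : ∀ s, I s → M s} {s : S} {x : M s} :
    x ∈ 𝓜.acl (SortedSet.range a) s ↔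
      ∃ φ : L.BFormula I [s], (𝓜.sol a φ).Finite ∧ x ∈ 𝓜.sol a φ := by
  constructor
  · rintro ⟨φ, hφ⟩
    refine ⟨φ.rename (freeRename (fun s y => y.2.choose) [s]), ?_⟩
    have e : 𝓜.sol a (φ.rename (freeRename (fun s y => y.2.choose) [s])) =
        𝓜.solutions (SortedSet.range a) φ := by
      ext y
      refine (φ.realize_freeRename _ _).trans ?_
      have : (fun s (y : SortedSet.range a s) => a s y.2.choose) = (SortedSet.range a).incl := by
        funext s y
        exact y.2.choose_spec
      rw [this]
      rfl
    rwa [e]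
  · rintro ⟨φ, hφ⟩
    refine ⟨φ.rename (freeRename (toRange a) [s]), ?_⟩
    have e : 𝓜.solutions (SortedSet.range a) (φ.rename (freeRename (toRange a) [s])) =
        𝓜.sol a φ := Set.ext fun y => φ.realize_freeRename _ _
    rwa [e]

theorem Language.Structure.acl_mono {A B : SortedSet M} (h : A ≤ B) : 𝓜.acl A ≤ 𝓜.acl B := by
  rintro s x ⟨φ, hφ⟩
  refine ⟨φ.rename (freeRename (fun s => Set.inclusion (h s)) [s]), ?_⟩
  have e : 𝓜.solutions B (φ.rename (freeRename (fun s => Set.inclusion (h s)) [s])) =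
      𝓜.solutions A φ := Set.ext fun y => φ.realize_freeRename _ _
  rwa [e]

theorem Language.Structure.le_acl (A : SortedSet M) : A ≤ 𝓜.acl A := by
  intro s x hx
  have e : 𝓜.solutions A (.equal (.var (.inr .zero)) (.var (.inl ⟨x, hx⟩))) = {x} := rfl
  exact ⟨_, by rw [e]; exact ⟨Set.finite_singleton x, rfl⟩⟩

theorem IsElementary.mem_sol_iff {f : ∀ s, N s → M s} (hf : IsElementary 𝓝 𝓜 f)
    (a : ∀ s, I s → N s) {s : S} (φ : L.BFormula I [s]) {x : N s} :
    f s x ∈ 𝓜.sol (fun s x => f s (a s x)) φ ↔ x ∈ 𝓝.sol a φ := by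
  let ψ : L.Formula N := φ.rename fun t y => .inl (Sum.elim (a t) (envCons x envNil t) y)
  have h₁ : ψ.Realize 𝓝 (fun _ y => y) envNil ↔ x ∈ 𝓝.sol a φ := by
    refine Language.BFormula.realize_rename ?_ φ
    rintro t (y | y) <;> rfl
  have h₂ : ψ.Realize 𝓜 f envNil ↔ f s x ∈ 𝓜.sol (fun s x => f s (a s x)) φ := by
    refine Language.BFormula.realize_rename ?_ φ
    rintro t (y | y)
    · rfl
    · cases y with
      | zero => rfl
      | succ y => nomatch y
  rw [← h₁, ← h₂, hf]

/-- A finite definable set does not grow in an elementary extension. -/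
theorem IsElementary.sol_eq_image {f : ∀ s, N s → M s} (hf : IsElementary 𝓝 𝓜 f)
    (a : ∀ s, I s → N s) {s : S} (φ : L.BFormula I [s]) (hφ : (𝓝.sol a φ).Finite) :
    𝓜.sol (fun s x => f s (a s x)) φ = f s '' 𝓝.sol a φ := by
  refine Set.Subset.antisymm (fun y hy => ?_) ?_
  · -- The sentence saying that the finitely many solutions in `𝓝` are all the solutions.
    let φ' : L.BFormula N [s] := φ.rename (freeRename a [s])
    let eqs : List (L.BFormula N [s]) :=
      hφ.toFinset.toList.map fun z => (Language.BFormula.equal (.var (.inr .zero)) (.var (.inl z))).not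
    let χ : L.Formula N := .all (.notAll (φ' :: eqs))
    have hχ : χ.Realize 𝓝 (fun _ y => y) envNil := by
      intro x
      rw [Language.BFormula.realize_notAll]
      intro h
      have hx : x ∈ 𝓝.sol a φ := (φ.realize_freeRename a _).1 (h φ' (by simp))
      exact h (Language.BFormula.equal (.var (.inr .zero)) (.var (.inl x))).not
        (List.mem_cons_of_mem _ (List.mem_map.2 ⟨x, by simpa using hx, rfl⟩)) rfl
    have h := (hf χ).2 hχ y
    rw [Language.BFormula.realize_notAll] at h
    by_contra hne
    refine h fun ψ hψ => ?_
    rcases List.mem_cons.1 hψ with rfl | hψ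
    · exact (φ.realize_freeRename _ _).2 hy
    · obtain ⟨z, hz, rfl⟩ := List.mem_map.1 hψ
      intro hyz
      exact hne ⟨z, by simpa using hz, Eq.symm hyz⟩
  · rintro _ ⟨x, hx, rfl⟩
    exact (hf.mem_sol_iff a φ).2 hx

/-- Algebraic closure is the same in a structure and in an elementary extension. -/
theorem IsElementary.acl_image {f : ∀ s, N s → M s} (hf : IsElementary 𝓝 𝓜 f)
    (A : SortedSet N) : 𝓜.acl (A.image f) = (𝓝.acl A).image f := by
  rw [SortedSet.image_eq_range]
  funext s
  ext y
  constructor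
  · intro hy
    obtain ⟨φ, hφ, hy⟩ := Language.Structure.mem_acl_range.1 hy
    have hfin : (𝓝.sol A.incl φ).Finite := by
      refine Set.Finite.of_finite_image (f := f s) (hφ.subset ?_) (hf.isEmbedding.injective s).injOn
      rintro _ ⟨x, hx, rfl⟩
      exact (hf.mem_sol_iff A.incl φ).2 hx
    have e := hf.sol_eq_image A.incl φ hfin
    obtain ⟨x, hx, rfl⟩ := e.subset hy
    exact ⟨x, ⟨φ, hfin, hx⟩, rfl⟩
  · rintro ⟨x, ⟨φ, hφ, hx⟩, rfl⟩
    have e := hf.sol_eq_image A.incl φ hφ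
    exact Language.Structure.mem_acl_range.2 ⟨φ, e ▸ hφ.image _, e.symm.subset ⟨x, hx, rfl⟩⟩

theorem Language.Structure.IsElementarySub.acl_le {A B : SortedSet M}
    (hB : 𝓜.IsElementarySub B) (h : A ≤ B) : 𝓜.acl A ≤ B := by
  obtain ⟨𝓑, hB⟩ := hB
  have e : A = SortedSet.image B.incl fun s => {x | x.1 ∈ A s} := by
    funext s
    ext x
    exact ⟨fun hx => ⟨⟨x, h s hx⟩, hx, rfl⟩, fun ⟨y, hy, e⟩ => e ▸ hy⟩
  rw [e, hB.acl_image]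
  rintro s _ ⟨x, _, rfl⟩
  exact x.2

theorem Language.Structure.IsElementarySub.funMap_mem {B : SortedSet M}
    (hB : 𝓜.IsElementarySub B) {w : List S} {s : S} (F : L.Functions w s)
    (x : ∀ j : Fin w.length, M (w.get j)) (hx : ∀ j, x j ∈ B _) : 𝓜.funMap F x ∈ B s := by
  obtain ⟨𝓑, hB⟩ := hB
  have := hB.isEmbedding.map_fun F fun j => ⟨x j, hx j⟩
  exact this ▸ Subtype.prop _

variable {A : SortedSet M}

/-- In a monster model, an element outside `acl A` is missed by some elementary substructure
containing `A`: since the type of the element over `A` has infinitely many realisations, it can be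
moved out of a given small elementary substructure by an automorphism fixing `A`. -/
theorem Language.Structure.IsMonster.exists_isElementarySub_notMem (h𝓜 : 𝓜.IsMonster κ) (hA : A.IsSmall κ)
    {s : S} {x : M s}
    (hx : x ∉ 𝓜.acl A s) : ∃ B : SortedSet M, A ≤ B ∧ 𝓜.IsElementarySub B ∧ x ∉ B s := by
  classical
  obtain ⟨B, hAB, hBs, 𝓑, hB⟩ :=
    Language.Structure.exists_isElementarySub (𝓜 := 𝓜) h𝓜.aleph0_lt h𝓜.card_lt hA
  let r := freeRename (fun s => Set.inclusion (hAB s)) [s]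
  have hr (φ : L.BFormula (fun s => A s) [s]) (y : M s) :
      (φ.rename r).Realize 𝓜 B.incl (envCons y envNil) ↔ y ∈ 𝓜.solutions A φ :=
    φ.realize_freeRename _ _
  let ne (z : B s) : L.BFormula (fun s => B s) [s] :=
    .imp (.equal (.var (.inr .zero)) (.var (.inl z))) .falsum
  obtain ⟨y, hy⟩ := h𝓜.saturated.exists_realize hBs B.incl
    ((fun φ => φ.rename r) '' {φ | x ∈ 𝓜.solutions A φ} ∪ Set.range ne) (by
      intro q hq
      -- Finitely many of these formulas follow from one formula `φ` in the type of `x` over `A`,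
      -- apart from finitely many exceptions `E`.
      have key : ∃ φ : L.BFormula (fun s => A s) [s], x ∈ 𝓜.solutions A φ ∧
          ∃ E : Set (M s), E.Finite ∧ ∀ y ∈ 𝓜.solutions A φ, y ∉ E →
            ∀ ψ ∈ q, ψ.Realize 𝓜 B.incl (envCons y envNil) := by
        induction q using Finset.induction_on with
        | empty => exact ⟨.not .falsum, fun h => h, ∅, Set.finite_empty, by simp⟩
        | insert ψ q _ ih =>
          obtain ⟨φ, hxφ, E, hE, h⟩ := ih fun θ hθ => hq (Finset.mem_insert_of_mem hθ)
          rcases hq (Finset.mem_insert_self ψ q) with ⟨θ, hθ, rfl⟩ | ⟨z, rfl⟩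
          · refine ⟨(φ.imp θ.not).not, fun h => h hxφ hθ, E, hE, fun y hy hyE => ?_⟩
            have hy' : y ∈ 𝓜.solutions A φ ∧ y ∈ 𝓜.solutions A θ := by
              by_contra hcon
              exact hy fun h₁ h₂ => hcon ⟨h₁, h₂⟩
            refine Finset.forall_mem_insert _ _ _ |>.2 ⟨(hr θ y).2 hy'.2, h y hy'.1 hyE⟩
          · refine ⟨φ, hxφ, insert z.1 E, hE.insert _, fun y hy hyE => ?_⟩
            refine Finset.forall_mem_insert _ _ _ |>.2
              ⟨fun h => hyE (Or.inl h), h y hy fun h => hyE (Or.inr h)⟩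
      obtain ⟨φ, hxφ, E, hE, h⟩ := key
      have hinf : (𝓜.solutions A φ).Infinite := fun hfin => hx ⟨φ, hfin, hxφ⟩
      obtain ⟨y, hy, hyE⟩ := (hinf.sdiff hE).nonempty
      exact ⟨y, h y hy hyE⟩)
  have hyB : y ∉ B s := fun h => hy (ne ⟨y, h⟩) (Or.inr ⟨_, rfl⟩) rfl
  have hyx : SameType 𝓜 𝓜 (fun t => Sum.elim (A.incl t) (envCons x envNil t))
      (fun t => Sum.elim (A.incl t) (envCons y envNil t)) := SameType.of_imp fun φ hφ => by
    rw [← realize_bindRename] at hφ ⊢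
    exact (hr _ _).1 (hy _ (Or.inl ⟨_, hφ, rfl⟩))
  have hs : CardLT κ fun t => A t ⊕ BVar [s] t := by
    refine CardLT.sum h𝓜.aleph0_lt.le hA ?_
    have := finite_bVar [s]
    exact (Cardinal.lt_aleph0_of_finite _).trans h𝓜.aleph0_lt
  obtain ⟨σ, ⟨hσ, hσs⟩, e⟩ := h𝓜.homogeneous _ _ _ hs (Language.Structure.typeEq_bot hyx.symm)
  have he := hσ.isElementary_of_surjective hσs
  refine ⟨B.image σ, fun t a ha => ⟨a, hAB t ha, e t (.inl ⟨a, ha⟩)⟩, ?_, ?_⟩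
  · rw [SortedSet.image_eq_range]
    exact IsElementary.isElementarySub_range (𝓠 := 𝓑)
      (SameType.isElementary ((hB.sameType fun _ x => x).trans (he.sameType _)))
  · rintro ⟨b, hb, hbx⟩
    have hyx' : σ s y = x := e s (.inr .zero)
    exact hyB (hσ.injective s (hyx'.trans hbx.symm) ▸ hb)

/-- Idempotence of `acl`, from its description as an intersection of elementary substructures. -/
theorem Language.Structure.IsMonster.acl_acl (h𝓜 : 𝓜.IsMonster κ) (hA : A.IsSmall κ) : 𝓜.acl (𝓜.acl A) = 𝓜.acl A := by
  refine le_antisymm (fun s x hx => ?_) (𝓜.le_acl _)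
  by_contra hne
  obtain ⟨B, hAB, hB, hxB⟩ := h𝓜.exists_isElementarySub_notMem hA hne
  exact hxB (hB.acl_le (hB.acl_le hAB) s hx)

theorem Language.Structure.IsMonster.isSmall_acl (h𝓜 : 𝓜.IsMonster κ) (hA : A.IsSmall κ) : (𝓜.acl A).IsSmall κ := by
  obtain ⟨B, hAB, hBs, hB⟩ :=
    Language.Structure.exists_isElementarySub (𝓜 := 𝓜) h𝓜.aleph0_lt h𝓜.card_lt hA
  exact hBs.mono (hB.acl_le hAB)

theorem Language.Structure.IsMonster.isSubstructure_acl (h𝓜 : 𝓜.IsMonster κ) (hA : A.IsSmall κ)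
    (hne : ∀ s, (A s).Nonempty) :
    𝓜.IsSubstructure (𝓜.acl A) := by
  have hfun {w : List S} {s : S} (F : L.Functions w s)
      (x : ∀ j : Fin w.length, 𝓜.acl A (w.get j)) : 𝓜.funMap F (fun j => (x j).1) ∈ 𝓜.acl A s := by
    by_contra hn
    obtain ⟨B, hAB, hB, hxB⟩ := h𝓜.exists_isElementarySub_notMem hA hn
    exact hxB (hB.funMap_mem F _ fun j => hB.acl_le hAB _ (x j).2)
  exact ⟨⟨fun s => ((hne s).mono (𝓜.le_acl A s)).to_subtype, fun F x => ⟨_, hfun F x⟩,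
    fun R x => 𝓜.relMap R fun j => (x j).1⟩,
    ⟨fun s => Subtype.val_injective, fun F x => rfl, fun R x => Iff.rfl⟩⟩

theorem Language.Structure.IsMonster.closure_le_acl (h𝓜 : 𝓜.IsMonster κ) (hA : A.IsSmall κ)
    (hne : ∀ s, (A s).Nonempty) :
    𝓜.closure A ≤ 𝓜.acl A :=
  sInf_le ⟨h𝓜.isSubstructure_acl hA hne, 𝓜.le_acl A⟩

end Acl

/-! ### Expansions of substructures -/

section Expansion

variable {L₀ L : Language S} {i : L₀.Hom L} {U Q : S → Type u} {𝓤 : L₀.Structure U}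
  {𝓠 : L.Structure Q} {T : L.Theory} {κ : Cardinal.{u}}

namespace ExpansionIn

/-- The expansion obtained by transporting an `L`-structure along an `L₀`-embedding. -/
noncomputable def ofEmbedding (𝓠 : L.Structure Q) (h : ∀ s, Q s → U s)
    (hh : IsEmbedding (𝓠.reduct i) 𝓤 h) : ExpansionIn i 𝓤 where
  carrier := SortedSet.range h
  str := 𝓠.onRange h
  isEmbedding := IsEmbedding.incl_range (𝓠 := 𝓠.reduct i) hh

theorem isElementary_ofEmbedding {h : ∀ s, Q s → U s} (hh : IsEmbedding (𝓠.reduct i) 𝓤 h) :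
    IsElementary 𝓠 (ofEmbedding 𝓠 h hh).str (toRange h) :=
  isElementary_toRange 𝓠 hh.injective

theorem isSub_ofEmbedding {h : ∀ s, Q s → U s} (hh : IsEmbedding (𝓠.reduct i) 𝓤 h)
    {A : ExpansionIn i 𝓤} {g : ∀ s, A.carrier s → Q s} (hg : IsEmbedding A.str 𝓠 g)
    (e : ∀ s x, h s (g s x) = x.1) : A.IsSub (ofEmbedding 𝓠 h hh) := by
  refine ⟨fun s x hx => ⟨g s ⟨x, hx⟩, e s ⟨x, hx⟩⟩, ?_⟩
  exact ((isEmbedding_toRange 𝓠 hh.injective).comp hg).congr fun s x => Subtype.ext (e s x)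

theorem ofEmbedding_isSub {h : ∀ s, Q s → U s} (hh : IsEmbedding (𝓠.reduct i) 𝓤 h)
    {A : ExpansionIn i 𝓤} {g : ∀ s, Q s → A.carrier s} (hg : IsEmbedding 𝓠 A.str g)
    (e : ∀ s x, (g s x).1 = h s x) : (ofEmbedding 𝓠 h hh).IsSub A := by
  have hle : SortedSet.range h ≤ A.carrier := by
    rintro s _ ⟨x, rfl⟩
    exact e s x ▸ (g s x).2
  refine ⟨hle, ?_⟩
  -- The inclusion is `g` precomposed with the inverse of the isomorphism onto the range.
  have hinv : IsEmbedding (𝓠.onRange h) 𝓠 fun s x => x.2.choose := by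
    have hr := isEmbedding_toRange 𝓠 hh.injective
    have hc : ∀ s (x : SortedSet.range h s), toRange h s x.2.choose = x := fun s x =>
      Subtype.ext x.2.choose_spec
    exact hr.of_comp ⟨fun s => Function.injective_id, fun F x => rfl, fun R x => Iff.rfl⟩ hc
  exact (hg.comp hinv).congr fun s x => Subtype.ext ((e s _).trans x.2.choose_spec)

theorem IsSub.trans {A B C : ExpansionIn i 𝓤} : A.IsSub B → B.IsSub C → A.IsSub C :=
  fun ⟨h, hAB⟩ ⟨h', hBC⟩ => ⟨h.trans h', hBC.comp hAB⟩

/-- For two substructures of `C`, inclusion of the universes is enough. -/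
theorem IsSub.of_le {A B C : ExpansionIn i 𝓤} (h : A.carrier ≤ B.carrier) :
    A.IsSub C → B.IsSub C → A.IsSub B :=
  fun ⟨_, hA⟩ ⟨_, hB⟩ => ⟨h, hB.of_comp hA fun _ _ => rfl⟩

/-- Every `L`-substructure of `N` is an expansion. -/
theorem exists_isSub (N : ExpansionIn i 𝓤) {K : SortedSet N.Univ} (hK : N.str.IsSubstructure K) :
    ∃ E : ExpansionIn i 𝓤, E.carrier = N.toAmbient K ∧ E.IsSub N := by
  obtain ⟨𝓚, hK⟩ := hK
  have h := N.isEmbedding.comp (hK.reduct i)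
  exact ⟨ofEmbedding 𝓚 _ h, (SortedSet.image_eq_range _ _).symm,
    ofEmbedding_isSub h hK fun _ _ => rfl⟩

theorem IsSub.models_universalPart {A B : ExpansionIn i 𝓤} (h : A.IsSub B)
    (hB : B.str.Models T) : A.str.Models T.universalPart :=
  h.2.models_universalPart hB

end ExpansionIn

end Expansion

/-! ### Automorphisms and images of sets -/

theorem IsAutomorphism.isElementary {L : Language S} {M : S → Type u} {𝓜 : L.Structure M}
    {σ : ∀ s, M s → M s} (hσ : IsAutomorphism 𝓜 σ) : IsElementary 𝓜 𝓜 σ :=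
  hσ.1.isElementary_of_surjective hσ.2

theorem isAutomorphism_id {L : Language S} {M : S → Type u} {𝓜 : L.Structure M} :
    IsAutomorphism 𝓜 fun _ x => x :=
  ⟨⟨fun _ => Function.injective_id, fun _ _ => rfl, fun _ _ => Iff.rfl⟩,
    fun _ => Function.surjective_id⟩

theorem Language.Structure.IsMonster.exists_automorphism {L : Language S} {M I : S → Type u}
    {𝓜 : L.Structure M} {κ : Cardinal.{u}} (h𝓜 : 𝓜.IsMonster κ) (hI : CardLT κ I)
    {a b : ∀ s, I s → M s} (hab : SameType 𝓜 𝓜 a b) :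
    ∃ σ : ∀ s, M s → M s, IsAutomorphism 𝓜 σ ∧ ∀ s j, σ s (a s j) = b s j :=
  h𝓜.homogeneous I a b hI (Language.Structure.typeEq_bot hab)

theorem SortedSet.image_eq_self {M : S → Type u} {σ : ∀ s, M s → M s} {A : SortedSet M}
    (h : ∀ s, ∀ x ∈ A s, σ s x = x) : A.image σ = A := by
  funext s
  refine Set.Subset.antisymm ?_ fun x hx => ⟨x, hx, h s x hx⟩
  rintro _ ⟨x, hx, rfl⟩
  rwa [h s x hx]

theorem SortedSet.image_sup {M N : S → Type u} (f : ∀ s, M s → N s) (A B : SortedSet M) :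
    (A ⊔ B).image f = A.image f ⊔ B.image f :=
  funext fun _ => Set.image_union _ _ _

theorem SortedSet.image_range {I M N : S → Type u} (f : ∀ s, M s → N s) (a : ∀ s, I s → M s) :
    (SortedSet.range a).image f = SortedSet.range fun s x => f s (a s x) :=
  funext fun _ => (Set.range_comp _ _).symm

theorem SortedSet.image_mono {M N : S → Type u} (f : ∀ s, M s → N s) {A B : SortedSet M}
    (h : A ≤ B) : A.image f ≤ B.image f :=
  fun s => Set.image_mono (h s)

/-! ### Models of derivation-like theories inside the monster model -/

/-- A monster model `𝓤₀` of the model complete theory `T₀`, an `L`-theory `T` containing `T₀` with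
model companion `Tplus`, and an independence relation `R₁` with respect to which `T` is
derivation-like. -/
structure IsDerivationLikeSetting {L₀ L : Language S} (i : L₀.Hom L) (T₀ : L₀.Theory)
    (T Tplus : L.Theory) (κ₀ : Cardinal.{u}) {U₀ : S → Type u} (𝓤₀ : L₀.Structure U₀)
    (R₁ : TernaryRel U₀) : Prop where
  modelComplete : T₀.IsModelComplete
  leAlong : T₀.LeAlong i T
  companion : Tplus.IsModelCompanion T
  le : T.Le Tplus
  models : 𝓤₀.Models T₀
  monster : 𝓤₀.IsMonster κ₀
  indep : 𝓤₀.IsIndependenceRelation κ₀ R₁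
  derivationLike : DerivationLike i 𝓤₀ κ₀ R₁ T

namespace IsDerivationLikeSetting

variable {L₀ L : Language S} {i : L₀.Hom L} {T₀ : L₀.Theory} {T Tplus : L.Theory}
  {κ₀ : Cardinal.{u}} {U₀ : S → Type u} {𝓤₀ : L₀.Structure U₀} {R₁ : TernaryRel U₀}
  {N Q J : S → Type u} {𝓝 : L.Structure N} {𝓠 : L.Structure Q}

theorem models_of_models_plus (H : IsDerivationLikeSetting i T₀ T Tplus κ₀ 𝓤₀ R₁)
    (h : 𝓝.Models Tplus) : 𝓝.Models T :=
  fun φ hφ => H.le φ hφ N 𝓝 h φ rfl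

theorem models_reduct (H : IsDerivationLikeSetting i T₀ T Tplus κ₀ 𝓤₀ R₁)
    (h : 𝓝.Models T) : (𝓝.reduct i).Models T₀ :=
  fun φ hφ => (φ.realize_map i).1 (H.leAlong φ hφ N 𝓝 h _ rfl)

theorem isElementary_reduct (H : IsDerivationLikeSetting i T₀ T Tplus κ₀ 𝓤₀ R₁)
    (hN : 𝓝.Models T) (hQ : 𝓠.Models T) {f : ∀ s, N s → Q s} (hf : IsEmbedding 𝓝 𝓠 f) :
    IsElementary (𝓝.reduct i) (𝓠.reduct i) f :=
  H.modelComplete _ _ _ _ (H.models_reduct hN) (H.models_reduct hQ) _ (hf.reduct i)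

theorem isElementary_incl (H : IsDerivationLikeSetting i T₀ T Tplus κ₀ 𝓤₀ R₁)
    {X : ExpansionIn i 𝓤₀} (hX : X.str.Models T) :
    IsElementary (X.str.reduct i) 𝓤₀ X.carrier.incl :=
  H.modelComplete _ _ _ _ (H.models_reduct hX) H.models _ X.isEmbedding

theorem acl_le_carrier (H : IsDerivationLikeSetting i T₀ T Tplus κ₀ 𝓤₀ R₁)
    {X : ExpansionIn i 𝓤₀} (hX : X.str.Models T) {A : SortedSet U₀} (hA : A ≤ X.carrier) :
    𝓤₀.acl A ≤ X.carrier :=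
  Language.Structure.IsElementarySub.acl_le ⟨_, H.isElementary_incl hX⟩ hA

/-- A set which is algebraically closed in a model of `T` inside `𝓤₀` is algebraically closed
in `𝓤₀`. -/
theorem acl_toAmbient (H : IsDerivationLikeSetting i T₀ T Tplus κ₀ 𝓤₀ R₁)
    {X : ExpansionIn i 𝓤₀} (hX : X.str.Models T) {A : SortedSet X.Univ} (hA : X.str.acl A = A) :
    𝓤₀.acl (X.toAmbient A) = X.toAmbient A := by
  refine le_antisymm ?_ (𝓤₀.le_acl _)
  rw [ExpansionIn.toAmbient, (H.isElementary_incl hX).acl_image]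
  refine SortedSet.image_mono _ ?_
  rintro s x ⟨φ, hφ⟩
  rw [← hA]
  have e : X.str.solutions A (φ.map i) = (X.str.reduct i).solutions A φ :=
    Set.ext fun y => φ.realize_map i
  exact ⟨φ.map i, by rwa [e]⟩

/-- A common algebraically closed substructure `E` of two small models of `Tplus` has the same type
in both: after moving one of them by an automorphism over `E`, both embed in a common model. -/
theorem sameType_of_isSub (H : IsDerivationLikeSetting i T₀ T Tplus κ₀ 𝓤₀ R₁)
    {X Y E : ExpansionIn i 𝓤₀} (hX : X.str.Models Tplus) (hY : Y.str.Models Tplus)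
    (hXs : X.carrier.IsSmall κ₀) (hYs : Y.carrier.IsSmall κ₀) (hEX : E.IsSub X)
    (hEY : E.IsSub Y) (hE : 𝓤₀.acl E.carrier = E.carrier) :
    SameType X.str Y.str (fun s => Set.inclusion (hEX.1 s)) fun s => Set.inclusion (hEY.1 s) := by
  have hEs := hXs.mono hEX.1
  obtain ⟨f, hf, hR⟩ := H.indep.full_existence X.carrier Y.carrier E.carrier hXs hYs hEs
  have hf' : SameType 𝓤₀ 𝓤₀ X.carrier.incl f :=
    SameType.of_comp (SameType.symm hf) (fun _ => .inl) (fun _ _ => rfl) fun _ _ => rfl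
  have hfE : ∀ s x, f s (Set.inclusion (hEX.1 s) x) = x.1 := fun s x =>
    (SameType.eq_iff hf (.inl (Set.inclusion (hEX.1 s) x)) (.inr x)).2 rfl
  have hfe : IsElementary (X.str.reduct i) 𝓤₀ f := SameType.isElementary
    (((H.isElementary_incl (H.models_of_models_plus hX)).sameType fun _ x => x).trans hf')
  -- The copy of `X` which is independent from `Y` over `E`.
  let X' := ExpansionIn.ofEmbedding X.str f hfe.isEmbedding
  have hXX' : IsElementary X.str X'.str (toRange f) :=
    ExpansionIn.isElementary_ofEmbedding hfe.isEmbedding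
  have hX' : X'.str.Models Tplus := hXX'.models_iff.1 hX
  have hEX' : E.IsSub X' := ExpansionIn.isSub_ofEmbedding _ hEX.2 hfE
  have hXT := H.models_of_models_plus hX'
  have hYT := H.models_of_models_plus hY
  obtain ⟨⟨W, hW, hXW, hYW⟩, -⟩ := H.derivationLike X' Y E
    (SortedSet.isSmall_range hXs f) hYs hEs
    (isAutomorphism_id.1.models_universalPart hXT) (isAutomorphism_id.1.models_universalPart hYT)
    (hEX.models_universalPart (H.models_of_models_plus hX)) hEX' hEY
    (by rw [hE]; exact inf_eq_left.2 hEX'.1) (by rw [hE]; exact inf_eq_left.2 hEY.1) hR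
  -- By model completeness of `Tplus`, both embeddings into a model of `Tplus` are elementary.
  obtain ⟨P, 𝓟, g, hP, hg⟩ := H.companion.2.1 _ _ hW
  have h₁ := H.companion.1 _ _ _ _ hX' hP _ (hg.comp hXW.2)
  have h₂ := H.companion.1 _ _ _ _ hY hP _ (hg.comp hYW.2)
  refine ((hXX'.sameType fun s => Set.inclusion (hEX.1 s)).trans (h₁.sameType _)).trans ?_
  refine SameType.of_comp (h₂.sameType fun s => Set.inclusion (hEY.1 s)).symm (fun _ x => x) ?_
    fun _ _ => rfl
  exact fun s x => congrArg (g s) (Subtype.ext (hfE s x).symm)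

/-- A small algebraically closed substructure `D` of a model `X` of `Tplus` has the same type as its
image under an automorphism of `𝓤₀` which is an `L`-embedding of `D` into a small model `Y`
of `Tplus`. -/
theorem sameType_of_automorphism (H : IsDerivationLikeSetting i T₀ T Tplus κ₀ 𝓤₀ R₁)
    (hL : L.card < κ₀) {X Y D : ExpansionIn i 𝓤₀} (hX : X.str.Models Tplus)
    (hY : Y.str.Models Tplus) (hYs : Y.carrier.IsSmall κ₀) (hDs : D.carrier.IsSmall κ₀)
    (hDX : D.IsSub X) (hD : 𝓤₀.acl D.carrier = D.carrier)
    {σ : ∀ s, U₀ s → U₀ s} (hσ : IsAutomorphism 𝓤₀ σ) {g : ∀ s, D.carrier s → Y.carrier s}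
    (hg : IsEmbedding D.str Y.str g) (e : ∀ s x, (g s x).1 = σ s x.1) :
    SameType X.str Y.str (fun s => Set.inclusion (hDX.1 s)) g := by
  obtain ⟨Z, hDZ, hZs, 𝓩, hZ⟩ := Language.Structure.exists_isElementarySub (𝓜 := X.str)
    H.monster.aleph0_lt hL (SortedSet.isSmall_range hDs fun s => Set.inclusion (hDX.1 s))
  let m : ∀ s, D.carrier s → Z s := fun s x => ⟨Set.inclusion (hDX.1 s) x, hDZ s ⟨x, rfl⟩⟩
  have hm : IsEmbedding D.str 𝓩 m := hZ.isEmbedding.of_comp hDX.2 fun _ _ => rfl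
  have hσD := hσ.1.comp D.isEmbedding
  have hσZ := hσ.1.comp (X.isEmbedding.comp (hZ.isEmbedding.reduct i))
  -- Replace `X` by a small elementary substructure `Z` containing `D`, and move it by `σ`.
  let E := ExpansionIn.ofEmbedding D.str _ hσD
  let X' := ExpansionIn.ofEmbedding 𝓩 _ hσZ
  have hDE := ExpansionIn.isElementary_ofEmbedding hσD
  have hZX' : IsElementary 𝓩 X'.str _ := ExpansionIn.isElementary_ofEmbedding hσZ
  have hEX' : E.IsSub X' := ExpansionIn.ofEmbedding_isSub hσD (hZX'.isEmbedding.comp hm)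
    fun _ _ => rfl
  have hEY : E.IsSub Y := ExpansionIn.ofEmbedding_isSub hσD hg e
  have hEcl : 𝓤₀.acl E.carrier = E.carrier := by
    have : E.carrier = D.carrier.image σ := (SortedSet.image_eq_range _ _).symm
    rw [this, hσ.isElementary.acl_image, hD]
  have key := H.sameType_of_isSub (hZX'.models_iff.1 (hZ.models_iff.2 hX)) hY
    (SortedSet.isSmall_range hZs _) hYs hEX' hEY hEcl
  refine ((hZ.sameType m).symm.trans (hZX'.sameType m)).trans
    (SameType.of_comp key (toRange _) (fun _ _ => rfl) fun s x => ?_)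
  exact Subtype.ext (e s x).symm

/-- Every small part of a model of `T` inside `𝓤₀` is contained in a small model of `Tplus`
inside `𝓤₀`, with the same `L`-substructures. -/
theorem exists_small_model (H : IsDerivationLikeSetting i T₀ T Tplus κ₀ 𝓤₀ R₁)
    (hL : L.card < κ₀) {W : ExpansionIn i 𝓤₀} (hW : W.str.Models T) {A : SortedSet U₀}
    (hA : A.IsSmall κ₀) (hAW : A ≤ W.carrier) :
    ∃ Y : ExpansionIn i 𝓤₀, Y.carrier.IsSmall κ₀ ∧ Y.str.Models Tplus ∧
      ∀ B : ExpansionIn i 𝓤₀, B.IsSub W → B.carrier ≤ A → B.IsSub Y := by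
  obtain ⟨P, 𝓟, g, hP, hg⟩ := H.companion.2.1 _ _ hW
  let gA : ∀ s, A s → P s := fun s x => g s (Set.inclusion (hAW s) x)
  obtain ⟨Z, hAZ, hZs, 𝓩, hZ⟩ := Language.Structure.exists_isElementarySub (𝓜 := 𝓟)
    H.monster.aleph0_lt hL (SortedSet.isSmall_range hA gA)
  let m : ∀ s, A s → Z s := fun s x => ⟨gA s x, hAZ s ⟨x, rfl⟩⟩
  have hab : SameType (𝓩.reduct i) 𝓤₀ m A.incl := by
    have h₁ := H.isElementary_reduct hW (H.models_of_models_plus hP) hg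
    have h₂ := ((h₁.sameType fun s => Set.inclusion (hAW s)).symm.trans
      ((H.isElementary_incl hW).sameType _))
    exact ((hZ.sameType m).reduct i).trans h₂
  -- Embed a small elementary substructure of a model of `Tplus` extending `W` into `𝓤₀` over `A`.
  obtain ⟨h, hh⟩ := hab.exists_extend H.monster.aleph0_lt.le H.monster.saturated hA hZs
    fun _ x => x
  have hhm : ∀ s x, h s (m s x) = x.1 := fun s x =>
    (hh.eq_iff (.inr (m s x)) (.inl x)).1 rfl
  have hhe : IsElementary (𝓩.reduct i) 𝓤₀ h := SameType.isElementary
    (hh.of_comp (fun _ => .inr) (fun _ _ => rfl) fun _ _ => rfl)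
  refine ⟨ExpansionIn.ofEmbedding 𝓩 h hhe.isEmbedding, SortedSet.isSmall_range hZs h,
    (ExpansionIn.isElementary_ofEmbedding hhe.isEmbedding).models_iff.1 (hZ.models_iff.2 hP),
    fun B hB hBA => ?_⟩
  exact ExpansionIn.isSub_ofEmbedding (g := fun s x => m s (Set.inclusion (hBA s) x)) _
    (hZ.isEmbedding.of_comp (hg.comp hB.2) fun _ _ => rfl) fun s x => hhm s _

/-- The second clause of derivation-likeness, for the algebraic closure of `A ∪ B`. -/
theorem exists_acl_isSub (H : IsDerivationLikeSetting i T₀ T Tplus κ₀ 𝓤₀ R₁)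
    {X A B C : ExpansionIn i 𝓤₀} (hX : X.str.Models T) (hA : A.carrier.IsSmall κ₀)
    (hB : B.carrier.IsSmall κ₀) (hAX : A.IsSub X) (hBX : B.IsSub X) (hCA : C.IsSub A)
    (hCB : C.IsSub B) (hC : 𝓤₀.acl C.carrier = C.carrier)
    (hR : R₁ A.carrier C.carrier B.carrier) :
    ∃ D : ExpansionIn i 𝓤₀, D.carrier = 𝓤₀.acl (A.carrier ⊔ B.carrier) ∧ D.IsSub X ∧
      ∀ E : ExpansionIn i 𝓤₀, E.carrier = 𝓤₀.acl (A.carrier ⊔ B.carrier) →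
        E.str.Models T.universalPart → A.IsSub E → B.IsSub E → E = D := by
  have hAB := SortedSet.IsSmall.sup H.monster.aleph0_lt.le hA hB
  have hne : ∀ s, ((A.carrier ⊔ B.carrier) s).Nonempty := fun s => by
    obtain ⟨x⟩ := A.str.nonempty s
    exact ⟨x.1, Or.inl x.2⟩
  refine (H.derivationLike A B C hA hB (hA.mono hCA.1) (hAX.models_universalPart hX)
    (hBX.models_universalPart hX) ((hCA.trans hAX).models_universalPart hX) hCA hCB
    (by rw [hC]; exact inf_eq_left.2 hCA.1) (by rw [hC]; exact inf_eq_left.2 hCB.1) hR).2 X hX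
    hAX hBX _ (H.monster.isSubstructure_acl hAB hne) (H.monster.closure_le_acl hAB hne)
    (le_inf le_rfl (H.acl_le_carrier hX (sup_le hAX.1 hBX.1)))

/-- Let `K` be a substructure of a model `X` of `Tplus`, given as a tuple `k`, and `A` another one,
independent over `C`. If an automorphism `σ` of `𝓤₀` fixing `A` maps `K` to a substructure of another
model `Y` of `Tplus` containing `A`, then `k` and its image have the same type over `A`. Indeed, by
uniqueness, `σ` is an `L`-isomorphism between the algebraic closures of `KA` and of its image. -/
theorem sameType_over (H : IsDerivationLikeSetting i T₀ T Tplus κ₀ 𝓤₀ R₁)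
    (hL : L.card < κ₀) {X Y A C : ExpansionIn i 𝓤₀} (hX : X.str.Models Tplus)
    (hY : Y.str.Models Tplus) (hYs : Y.carrier.IsSmall κ₀) (hA : A.carrier.IsSmall κ₀)
    (hAX : A.IsSub X) (hAY : A.IsSub Y) (hCA : C.IsSub A) (hC : 𝓤₀.acl C.carrier = C.carrier)
    {𝓙 : L.Structure J} (hJ : CardLT κ₀ J) {k : ∀ s, J s → X.carrier s}
    (hk : IsEmbedding 𝓙 X.str k) (hCk : ∀ s, ∀ x ∈ C.carrier s, ∃ j, (k s j).1 = x)
    (hR : R₁ (SortedSet.range fun s j => (k s j).1) C.carrier A.carrier)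
    {σ : ∀ s, U₀ s → U₀ s} (hσ : IsAutomorphism 𝓤₀ σ) (hσA : ∀ s, ∀ x ∈ A.carrier s, σ s x = x)
    {c : ∀ s, J s → Y.carrier s} (hc : IsEmbedding 𝓙 Y.str c)
    (e : ∀ s j, σ s (k s j).1 = (c s j).1) :
    SameType X.str Y.str (fun s => Sum.elim (k s) (Set.inclusion (hAX.1 s)))
      (fun s => Sum.elim (c s) (Set.inclusion (hAY.1 s))) := by
  have hXT := H.models_of_models_plus hX
  have hYT := H.models_of_models_plus hY
  have hk₀ := X.isEmbedding.comp (hk.reduct i)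
  have hc₀ := Y.isEmbedding.comp (hc.reduct i)
  let K := ExpansionIn.ofEmbedding 𝓙 _ hk₀
  let K' := ExpansionIn.ofEmbedding 𝓙 _ hc₀
  have hKs : K.carrier.IsSmall κ₀ := SortedSet.isSmall_range hJ _
  have hKX : K.IsSub X := ExpansionIn.ofEmbedding_isSub hk₀ hk fun _ _ => rfl
  have hK'Y : K'.IsSub Y := ExpansionIn.ofEmbedding_isSub hc₀ hc fun _ _ => rfl
  have hσC : ∀ s, ∀ x ∈ C.carrier s, σ s x = x := fun s x hx => hσA s x (hCA.1 s hx)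
  -- `C` is a substructure of both `K` and its image.
  choose kC hkC using fun s (x : C.carrier s) => hCk s x.1 x.2
  have hkCemb : IsEmbedding C.str 𝓙 kC :=
    hk.of_comp (hCA.trans hAX).2 fun s x => Subtype.ext (hkC s x)
  have hCK : C.IsSub K := ExpansionIn.isSub_ofEmbedding hk₀ hkCemb hkC
  have hCK' : C.IsSub K' := ExpansionIn.isSub_ofEmbedding hc₀ hkCemb fun s x =>
    (e s _).symm.trans (by rw [hkC, hσC s _ x.2])
  have hK' : K.carrier.image σ = K'.carrier := by
    refine (SortedSet.image_range _ _).trans (congrArg SortedSet.range ?_)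
    funext s j
    exact e s j
  have hR' : R₁ K'.carrier C.carrier A.carrier := by
    have := H.indep.invariant σ hσ _ _ _ hKs hA (hA.mono hCA.1) hR
    rwa [SortedSet.image_eq_self hσA, SortedSet.image_eq_self hσC, hK'] at this
  obtain ⟨D, hD, hDX, -⟩ := H.exists_acl_isSub hXT hKs hA hKX hAX hCK hCA hC hR
  obtain ⟨D', hD', hD'Y, huniq⟩ := H.exists_acl_isSub hYT (SortedSet.isSmall_range hJ _) hA
    hK'Y hAY hCK' hCA hC hR'
  have hKA := SortedSet.IsSmall.sup H.monster.aleph0_lt.le hKs hA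
  have hKD : K.carrier ≤ D.carrier := hD ▸ le_sup_left.trans (𝓤₀.le_acl _)
  have hAD : A.carrier ≤ D.carrier := hD ▸ le_sup_right.trans (𝓤₀.le_acl _)
  have hKsubD : K.IsSub D := hKX.of_le hKD hDX
  have hAsubD : A.IsSub D := hAX.of_le hAD hDX
  have hσD := hσ.1.comp D.isEmbedding
  -- The image of `D = acl(KA)` under `σ` coincides with `D'` by uniqueness.
  let E := ExpansionIn.ofEmbedding D.str _ hσD
  have hDE : IsElementary D.str E.str (toRange _) := ExpansionIn.isElementary_ofEmbedding hσD
  have hEc : E.carrier = 𝓤₀.acl (K'.carrier ⊔ A.carrier) := by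
    have h₁ : E.carrier = D.carrier.image σ := (SortedSet.image_eq_range _ _).symm
    rw [h₁, hD, ← hσ.isElementary.acl_image, SortedSet.image_sup, hK',
      SortedSet.image_eq_self hσA]
  let kD : ∀ s, J s → D.carrier s := fun s j => ⟨(k s j).1, hKD s ⟨j, rfl⟩⟩
  have hkD : IsEmbedding 𝓙 D.str kD := hDX.2.of_comp hk fun _ _ => rfl
  have hK'E : K'.IsSub E :=
    ExpansionIn.ofEmbedding_isSub hc₀ (hDE.isEmbedding.comp hkD) fun s j => e s j
  have hAE : A.IsSub E := ExpansionIn.isSub_ofEmbedding hσD hAsubD.2 fun s x => hσA s x.1 x.2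
  have hED' : E = D' :=
    huniq E hEc (hDE.models_iff.1 (hDX.models_universalPart hXT)) hK'E hAE
  have hEY : E.IsSub Y := hED' ▸ hD'Y
  have hDs : D.carrier.IsSmall κ₀ := hD ▸ H.monster.isSmall_acl hKA
  have key := H.sameType_of_automorphism hL hX hY hYs hDs hDX
    (by rw [hD, H.monster.acl_acl hKA]) hσ (hEY.2.comp hDE.isEmbedding) fun _ _ => rfl
  refine key.of_comp (fun s => Sum.elim (kD s) (Set.inclusion (hAD s))) ?_ ?_
  · rintro s (j | x) <;> rfl
  · rintro s (j | x)
    · exact Subtype.ext (e s j)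
    · exact Subtype.ext (hσA s x.1 x.2)

end IsDerivationLikeSetting

/-! ### The independence theorem -/

namespace IsDerivationLikeSetting

variable {L₀ L : Language S} {i : L₀.Hom L} {T₀ : L₀.Theory} {T Tplus : L.Theory}
  {κ₀ κplus : Cardinal.{u}} {U₀ : S → Type u} {𝓤₀ : L₀.Structure U₀} {R₀ R₁ : TernaryRel U₀}

/-- The amalgamation step of the independence theorem over the model `C`, with substructures
`A₁`, `A₂` of a closed set `B`, and tuples `k₁`, `k₂` with the same `L`-diagram: if `c` in `𝓤₀` has the
`L₀`-type of `kⱼ` over `Aⱼ` and is independent from `B`, then some `d` in `X` has the `L₀`-type of `c`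
over `B` and the `L`-type of `kⱼ` over `Aⱼ`. -/
theorem exists_amalgam (H : IsDerivationLikeSetting i T₀ T Tplus κ₀ 𝓤₀ R₁)
    (hκ : κplus ≤ κ₀) {X : ExpansionIn i 𝓤₀} (hX : X.str.Models Tplus)
    (hXm : X.str.IsMonster κplus) {J : S → Type u} {𝓙 : L.Structure J} (hJ : CardLT κplus J)
    {A₁ A₂ B C : ExpansionIn i 𝓤₀} (hB : B.carrier.IsSmall κplus) (hBX : B.IsSub X)
    (hA₁ : A₁.IsSub B) (hA₂ : A₂.IsSub B) (hCA₁ : C.IsSub A₁) (hCA₂ : C.IsSub A₂)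
    (hC : 𝓤₀.acl C.carrier = C.carrier) (hBcl : 𝓤₀.acl B.carrier = B.carrier)
    {k₁ k₂ : ∀ s, J s → X.carrier s} (hk₁ : IsEmbedding 𝓙 X.str k₁)
    (hk₂ : IsEmbedding 𝓙 X.str k₂) (hCk₁ : ∀ s, ∀ x ∈ C.carrier s, ∃ j, (k₁ s j).1 = x)
    (hCk₂ : ∀ s, ∀ x ∈ C.carrier s, ∃ j, (k₂ s j).1 = x)
    (hR₁ : R₁ (SortedSet.range fun s j => (k₁ s j).1) C.carrier A₁.carrier)
    (hR₂ : R₁ (SortedSet.range fun s j => (k₂ s j).1) C.carrier A₂.carrier)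
    {c : ∀ s, J s → U₀ s}
    (hc₁ : 𝓤₀.TypeEq A₁.carrier (fun s j => (k₁ s j).1) c)
    (hc₂ : 𝓤₀.TypeEq A₂.carrier (fun s j => (k₂ s j).1) c)
    (hRc : R₁ (SortedSet.range c) C.carrier B.carrier) :
    ∃ d : ∀ s, J s → X.carrier s,
      SameType 𝓤₀ 𝓤₀ (fun s => Sum.elim (B.carrier.incl s) (c s))
        (fun s => Sum.elim (B.carrier.incl s) fun j => (d s j).1) ∧
      SameType X.str X.str (fun s => Sum.elim (k₁ s) (Set.inclusion ((hA₁.trans hBX).1 s)))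
        (fun s => Sum.elim (d s) (Set.inclusion ((hA₁.trans hBX).1 s))) ∧
      SameType X.str X.str (fun s => Sum.elim (k₂ s) (Set.inclusion ((hA₂.trans hBX).1 s)))
        (fun s => Sum.elim (d s) (Set.inclusion ((hA₂.trans hBX).1 s))) := by
  have hℵ := H.monster.aleph0_lt.le
  have hL : L.card < κ₀ := hXm.card_lt.trans_le hκ
  have hXT := H.models_of_models_plus hX
  have hB₀ : B.carrier.IsSmall κ₀ := CardLT.mono hB hκ
  have hJ₀ : CardLT κ₀ J := hJ.mono hκ
  obtain ⟨σ₁, hσ₁, e₁⟩ := H.monster.exists_automorphism (hJ₀.sum hℵ (hB₀.mono hA₁.1)) hc₁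
  obtain ⟨σ₂, hσ₂, e₂⟩ := H.monster.exists_automorphism (hJ₀.sum hℵ (hB₀.mono hA₂.1)) hc₂
  have hc : IsEmbedding (𝓙.reduct i) 𝓤₀ c :=
    (hσ₁.1.comp (X.isEmbedding.comp (hk₁.reduct i))).congr fun s j => e₁ s (.inl j)
  -- A model of `T` containing `c`, with the structure transported from `k₁`, and `B`.
  let K := ExpansionIn.ofEmbedding 𝓙 c hc
  have hKs : K.carrier.IsSmall κ₀ := SortedSet.isSmall_range hJ₀ c
  choose kC hkC using fun s (x : C.carrier s) => hCk₁ s x.1 x.2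
  have hkCemb : IsEmbedding C.str 𝓙 kC :=
    hk₁.of_comp ((hCA₁.trans hA₁).trans hBX).2 fun s x => Subtype.ext (hkC s x)
  have hckC : ∀ s x, c s (kC s x) = x.1 := fun s x => by
    have h₁ : σ₁ s (k₁ s (kC s x)).1 = c s (kC s x) := e₁ s (.inl _)
    have h₂ : σ₁ s x.1 = x.1 := e₁ s (.inr ⟨x.1, hCA₁.1 s x.2⟩)
    rw [← h₁, hkC, h₂]
  have hCK : C.IsSub K := ExpansionIn.isSub_ofEmbedding hc hkCemb hckC
  have hCB := hCA₁.trans hA₁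
  have hJT : 𝓙.Models T.universalPart := hk₁.models_universalPart hXT
  obtain ⟨⟨W, hW, hKW, hBW⟩, -⟩ := H.derivationLike K B C hKs hB₀ (hB₀.mono hCB.1)
    ((ExpansionIn.isElementary_ofEmbedding hc).models_iff.1 hJT)
    (hBX.models_universalPart hXT) ((hCB.trans hBX).models_universalPart hXT) hCK hCB
    (by rw [hC]; exact inf_eq_left.2 hCK.1) (by rw [hC]; exact inf_eq_left.2 hCB.1) hRc
  obtain ⟨Y, hYs, hY, hYsub⟩ := H.exists_small_model hL hW
    (SortedSet.IsSmall.sup hℵ hKs hB₀) (sup_le hKW.1 hBW.1)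
  have hKY : K.IsSub Y := hYsub K hKW le_sup_left
  have hBY : B.IsSub Y := hYsub B hBW le_sup_right
  have hYT := H.models_of_models_plus hY
  let cY : ∀ s, J s → Y.carrier s := fun s j => ⟨c s j, hKY.1 s ⟨j, rfl⟩⟩
  have hcY : IsEmbedding 𝓙 Y.str cY :=
    hKY.2.comp (ExpansionIn.isElementary_ofEmbedding hc).isEmbedding
  -- The types of `c` over `A₁` and `A₂` in this model are those of `k₁` and `k₂`.
  have key₁ := H.sameType_over hL hX hY hYs (hB₀.mono hA₁.1) (hA₁.trans hBX) (hA₁.trans hBY)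
    hCA₁ hC hJ₀ hk₁ hCk₁ hR₁ hσ₁ (fun s x hx => e₁ s (.inr ⟨x, hx⟩)) hcY fun s j => e₁ s (.inl j)
  have key₂ := H.sameType_over hL hX hY hYs (hB₀.mono hA₂.1) (hA₂.trans hBX) (hA₂.trans hBY)
    hCA₂ hC hJ₀ hk₂ hCk₂ hR₂ hσ₂ (fun s x hx => e₂ s (.inr ⟨x, hx⟩)) hcY fun s j => e₂ s (.inl j)
  have keyB := H.sameType_of_automorphism hL hX hY hYs hB₀ hBX hBcl isAutomorphism_id hBY.2
    fun _ _ => rfl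
  -- By saturation, the type of `c` over `B` is realised in `X`.
  obtain ⟨d, hd⟩ := keyB.symm.exists_extend hXm.aleph0_lt.le hXm.saturated hB hJ cY
  refine ⟨d, ?_, ?_, ?_⟩
  · have h₁ := (H.isElementary_incl hYT).sameType
      fun s => Sum.elim (Set.inclusion (hBY.1 s)) (cY s)
    have h₂ := (H.isElementary_incl hXT).sameType
      fun s => Sum.elim (Set.inclusion (hBX.1 s)) (d s)
    refine SameType.of_comp ((h₁.symm.trans (hd.reduct i)).trans h₂) (fun _ x => x) ?_ ?_ <;>
    · rintro s (x | x) <;> rfl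
  · refine key₁.trans (hd.of_comp
      (fun s => Sum.elim .inr fun x => .inl (Set.inclusion (hA₁.1 s) x)) ?_ ?_) <;>
    · rintro s (x | x) <;> rfl
  · refine key₂.trans (hd.of_comp
      (fun s => Sum.elim .inr fun x => .inl (Set.inclusion (hA₂.1 s) x)) ?_ ?_) <;>
    · rintro s (x | x) <;> rfl

end IsDerivationLikeSetting

end ManySorted

theorem mainTheorem5 {S : Type u} (L₀ L : ManySorted.Language S) (i : L₀.Hom L) (hi : i.Injective)
    (T₀ : L₀.Theory) (hT₀ : T₀.IsComplete) (hT₀mc : T₀.IsModelComplete)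
    (T Tplus : L.Theory) (hT₀T : T₀.LeAlong i T)
    (hcomp : Tplus.IsModelCompanion T) (hTTplus : T.Le Tplus)
    (κ₀ κplus : Cardinal.{u}) (hκ : κplus ≤ κ₀)
    -- the monster model of `T₀`
    (U₀ : S → Type u) (𝓤₀ : L₀.Structure U₀) (hU₀ : 𝓤₀.Models T₀) (hU₀m : 𝓤₀.IsMonster κ₀)
    -- the monster model of a completion of `Tplus`, an `L₀`-substructure of the former
    (Uplus : ExpansionIn i 𝓤₀) (hUplus : Uplus.str.Models Tplus) (hUplusm : Uplus.str.IsMonster κplus)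
    (R₀ R₁ : TernaryRel U₀) (hR₀ : 𝓤₀.Invariant κ₀ R₀) (hR₁ : 𝓤₀.IsIndependenceRelation κ₀ R₁)
    (hT : DerivationLike i 𝓤₀ κ₀ R₁ T)
    -- a small model of `Tplus`
    (M : SortedSet Uplus.Univ) (hMsmall : M.IsSmall κplus) (hM : Uplus.str.IsSubmodel Tplus M)
    (hR₀R₁ : ∀ A B : SortedSet U₀, A.IsSmall κ₀ → B.IsSmall κ₀ →
      R₀ A (Uplus.toAmbient M) B → R₁ A (Uplus.toAmbient M) B)
    (hmono : MonotonicityOver κ₀ R₀ (Uplus.toAmbient M))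
    (hsymm : SymmetryOver κ₀ R₀ (Uplus.toAmbient M))
    (hext : 𝓤₀.ExtensionOver κ₀ R₀ (Uplus.toAmbient M))
    (hind : 𝓤₀.IndependenceTheoremOver κ₀ R₀ (Uplus.toAmbient M)) :
    Uplus.str.IndependenceTheoremOver κplus (Uplus.inducedRel R₀) M := by
  intro A₁ A₂ I a₁ a₂ hA₁ hA₂ hI h₁₂ h₁ h₂ ha
  have H : IsDerivationLikeSetting i T₀ T Tplus κ₀ 𝓤₀ R₁ :=
    ⟨hT₀mc, hT₀T, hcomp, hTTplus, hU₀, hU₀m, hR₁, hT⟩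
  have hℵ := hUplusm.aleph0_lt.le
  have hℵ₀ := hU₀m.aleph0_lt.le
  have hUT := H.models_of_models_plus hUplus
  have hu := H.isElementary_incl hUT
  have hMel : Uplus.str.IsElementarySub M := by
    obtain ⟨𝓜, hM₁, hM₂⟩ := hM
    exact ⟨𝓜, hcomp.1 _ _ _ _ hM₂ hUplus _ hM₁⟩
  have hMne : ∀ s, (M s).Nonempty := fun s => by
    obtain ⟨𝓜, _, _⟩ := hM
    obtain ⟨x⟩ := 𝓜.nonempty s
    exact ⟨x.1, x.2⟩
  have hMcl : Uplus.str.acl M = M := le_antisymm (hMel.acl_le le_rfl) (Uplus.str.le_acl M)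
  -- Algebraically closed sets containing `M` carry substructures.
  have hsmall {A : SortedSet Uplus.Univ} (hA : A.IsSmall κplus) : (A ⊔ M).IsSmall κplus :=
    SortedSet.IsSmall.sup hℵ hA hMsmall
  have hamb {A : SortedSet Uplus.Univ} (hA : A.IsSmall κplus) :
      (Uplus.toAmbient A).IsSmall κ₀ := CardLT.mono (hA.image _) hκ
  have hsub {A : SortedSet Uplus.Univ} (hA : A.IsSmall κplus) :
      Uplus.str.IsSubstructure (Uplus.str.acl (A ⊔ M)) :=
    hUplusm.isSubstructure_acl (hsmall hA) fun s => (hMne s).mono fun x hx => Or.inr hx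
  have hMle (A : SortedSet Uplus.Univ) : M ≤ Uplus.str.acl (A ⊔ M) :=
    le_sup_right.trans (Uplus.str.le_acl _)
  have hMacl : 𝓤₀.acl (Uplus.toAmbient M) = Uplus.toAmbient M := H.acl_toAmbient hUT hMcl
  obtain ⟨ME, hME, hMEU⟩ := Uplus.exists_isSub (K := M) ⟨_, hM.choose_spec.1⟩
  obtain ⟨E₁, hE₁, hE₁U⟩ := Uplus.exists_isSub (hsub hA₁)
  obtain ⟨E₂, hE₂, hE₂U⟩ := Uplus.exists_isSub (hsub hA₂)
  have hA₁₂ := SortedSet.IsSmall.sup hℵ hA₁ hA₂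
  obtain ⟨B, hB, hBU⟩ := Uplus.exists_isSub (hsub hA₁₂)
  have hBs : B.carrier.IsSmall κplus := hB ▸ (hUplusm.isSmall_acl (hsmall hA₁₂)).image _
  have hE₁B : E₁.IsSub B := hE₁U.of_le (by
    rw [hE₁, hB]
    exact SortedSet.image_mono _ (Uplus.str.acl_mono (sup_le_sup_right le_sup_left _))) hBU
  have hE₂B : E₂.IsSub B := hE₂U.of_le (by
    rw [hE₂, hB]
    exact SortedSet.image_mono _ (Uplus.str.acl_mono (sup_le_sup_right le_sup_right _))) hBU
  have hME₁ : ME.IsSub E₁ := hMEU.of_le (by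
    rw [hME, hE₁]
    exact SortedSet.image_mono _ (hMle _)) hE₁U
  have hME₂ : ME.IsSub E₂ := hMEU.of_le (by
    rw [hME, hE₂]
    exact SortedSet.image_mono _ (hMle _)) hE₂U
  have hBcl : 𝓤₀.acl B.carrier = B.carrier := by
    rw [hB]
    exact H.acl_toAmbient hUT (hUplusm.acl_acl (hsmall hA₁₂))
  -- An automorphism over `M` extends `a₁ ↦ a₂` to the algebraic closures.
  obtain ⟨τ, hτ, eτ⟩ := hUplusm.exists_automorphism (hI.sum hℵ hMsmall) ha
  have ra₁ := SortedSet.isSmall_range hI a₁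
  have hclosure {ρ : ∀ s, Uplus.Univ s → Uplus.Univ s} (hρ : IsAutomorphism Uplus.str ρ)
      (hρM : ∀ s, ∀ x ∈ M s, ρ s x = x) {a : ∀ s, I s → Uplus.Univ s}
      (hρa : ∀ s j, ρ s (a₁ s j) = a s j) :
      (Uplus.str.acl (SortedSet.range a₁ ⊔ M)).image ρ =
        Uplus.str.acl (SortedSet.range a ⊔ M) := by
    rw [← hρ.isElementary.acl_image, SortedSet.image_sup, SortedSet.image_eq_self hρM,
      SortedSet.image_range]
    simp only [hρa]
  let J : S → Type u := fun s => Uplus.str.acl (SortedSet.range a₁ ⊔ M) s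
  have hJ : CardLT κplus J := hUplusm.isSmall_acl (hsmall ra₁)
  obtain ⟨𝓙, hk₁⟩ := hsub ra₁
  let k₁ : ∀ s, J s → Uplus.Univ s := fun s x => x.1
  let k₂ : ∀ s, J s → Uplus.Univ s := fun s x => τ s x.1
  have hk₂ : IsEmbedding 𝓙 Uplus.str k₂ := hτ.1.comp hk₁
  have rk₁ : SortedSet.range (fun s j => (k₁ s j).1) =
      Uplus.toAmbient (Uplus.str.acl (SortedSet.range a₁ ⊔ M)) :=
    (SortedSet.image_eq_range _ _).symm
  have rk₂ : SortedSet.range (fun s j => (k₂ s j).1) =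
      Uplus.toAmbient (Uplus.str.acl (SortedSet.range a₂ ⊔ M)) := by
    rw [← hclosure (a := a₂) hτ (fun s x hx => eτ s (.inr ⟨x, hx⟩)) fun s j => eτ s (.inl j),
      SortedSet.image_eq_range, ExpansionIn.toAmbient, SortedSet.image_range]
    rfl
  change R₀ _ _ _ at h₁₂ h₁ h₂
  rw [hMcl, ← hE₁, ← hE₂] at h₁₂
  rw [hMcl, ← hE₁, ← rk₁] at h₁
  rw [hMcl, ← hE₂, ← rk₂] at h₂
  have hE₁s : E₁.carrier.IsSmall κ₀ := CardLT.mono (hBs.mono hE₁B.1) hκ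
  have hE₂s : E₂.carrier.IsSmall κ₀ := CardLT.mono (hBs.mono hE₂B.1) hκ
  have hBs₀ : B.carrier.IsSmall κ₀ := CardLT.mono hBs hκ
  have hk₁₂ : 𝓤₀.TypeEq (Uplus.toAmbient M) (fun s j => (k₁ s j).1) fun s j => (k₂ s j).1 := by
    have hτ' := ((hτ.isElementary.sameType
      fun s => Sum.elim (k₁ s) (M.incl s)).reduct i)
    refine SameType.of_comp (((hu.sameType _).symm.trans hτ').trans (hu.sameType _))
      (fun s => Sum.map id fun x => ⟨x.2.choose, x.2.choose_spec.1⟩) ?_ ?_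
    · rintro s (x | x)
      · rfl
      · exact x.2.choose_spec.2
    · rintro s (x | x)
      · rfl
      · exact (congrArg Subtype.val (eτ s (.inr ⟨_, x.2.choose_spec.1⟩))).trans
          x.2.choose_spec.2
  -- The independence theorem and extension in `𝓤₀`.
  obtain ⟨c₀, hc₀₁, hc₀₂, hRc₀⟩ := hind _ _ _ _ _ hE₁s hE₂s (hJ.mono hκ) h₁₂ h₁ h₂ hk₁₂
  obtain ⟨f, hf, hRf⟩ := hext _ _ B.carrier (SortedSet.isSmall_range (hJ.mono hκ) c₀)
    (SortedSet.IsSmall.sup hℵ₀ hE₁s hE₂s) hBs₀ hRc₀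
  rw [sup_eq_right.2 (sup_le hE₁B.1 hE₂B.1)] at hRf
  let c : ∀ s, J s → U₀ s := fun s j => f s (toRange c₀ s j)
  have rc : SortedSet.range f = SortedSet.range c :=
    funext fun s => ((toRange_surjective c₀ s).range_comp (f s)).symm
  have hc {E : SortedSet U₀} (hE : E ≤ E₁.carrier ⊔ E₂.carrier) :
      𝓤₀.TypeEq E c₀ c := by
    refine SameType.of_comp (hf.sameType (hE.trans le_sup_left)).symm
      (fun s => Sum.map (toRange c₀ s) id) ?_ ?_ <;>
    · rintro s (x | x) <;> rfl
  have hc₁ : 𝓤₀.TypeEq E₁.carrier (fun s j => (k₁ s j).1) c :=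
    SameType.trans (hc₀₁.sameType le_sup_right).symm (hc le_sup_left)
  have hc₂ : 𝓤₀.TypeEq E₂.carrier (fun s j => (k₂ s j).1) c :=
    SameType.trans (hc₀₂.sameType le_sup_right).symm (hc le_sup_right)
  rw [rc] at hRf
  have rcs : (SortedSet.range c).IsSmall κ₀ := SortedSet.isSmall_range (hJ.mono hκ) c
  have hMk₂ : Uplus.toAmbient M ≤ SortedSet.range fun s j => (k₂ s j).1 := by
    rw [rk₂]
    exact SortedSet.image_mono _ (hMle _)
  have hMk₁ : Uplus.toAmbient M ≤ SortedSet.range fun s j => (k₁ s j).1 := by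
    rw [rk₁]
    exact SortedSet.image_mono _ (hMle _)
  obtain ⟨d, hd, hd₁, hd₂⟩ := H.exists_amalgam hκ hUplus hUplusm hJ hBs hBU hE₁B hE₂B hME₁ hME₂
    (by rw [hME, hMacl]) hBcl hk₁ hk₂ (by rw [hME]; exact hMk₁) (by rw [hME]; exact hMk₂)
    (by
      rw [hME]
      exact hR₀R₁ _ _ (SortedSet.isSmall_range (hJ.mono hκ) _) hE₁s h₁)
    (by
      rw [hME]
      exact hR₀R₁ _ _ (SortedSet.isSmall_range (hJ.mono hκ) _) hE₂s h₂)
    hc₁ hc₂ (by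
      rw [hME]
      exact hR₀R₁ _ _ rcs hBs₀ hRf)
  have ha₁J : ∀ s j, a₁ s j ∈ Uplus.str.acl (SortedSet.range a₁ ⊔ M) s := fun s j =>
    Uplus.str.le_acl _ s (Or.inl ⟨j, rfl⟩)
  let a : ∀ s, I s → Uplus.Univ s := fun s j => d s ⟨a₁ s j, ha₁J s j⟩
  have hmem {A : SortedSet Uplus.Univ} {E : ExpansionIn i 𝓤₀}
      (hE : E.carrier = Uplus.toAmbient (Uplus.str.acl (A ⊔ M))) (s : S) (x : (M ⊔ A) s) :
      x.1.1 ∈ E.carrier s := by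
    rw [hE]
    exact ⟨x.1, Uplus.str.le_acl _ s (x.2.symm), rfl⟩
  refine ⟨a, ?_, ?_, ?_⟩
  · refine SameType.of_comp hd₁.symm
      (fun s => Sum.map (fun j => ⟨a₁ s j, ha₁J s j⟩) fun x => ⟨x.1.1, hmem hE₁ s x⟩) ?_ ?_ <;>
    · rintro s (x | x) <;> rfl
  · refine SameType.of_comp hd₂.symm
      (fun s => Sum.map (fun j => ⟨a₁ s j, ha₁J s j⟩) fun x => ⟨x.1.1, hmem hE₂ s x⟩) ?_ ?_
    · rintro s (x | x) <;> rfl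
    · rintro s (x | x)
      · exact eτ s (.inl x)
      · rfl
  · -- `d` enumerates the algebraic closure of `a` and `M`, by an automorphism `k₁ ↦ d` over `M`.
    obtain ⟨ρ, hρ, eρ⟩ := hUplusm.exists_automorphism (hJ.sum hℵ (hBs.mono hE₁B.1)) hd₁
    have rd : SortedSet.range (fun s j => (d s j).1) =
        Uplus.toAmbient (Uplus.str.acl (SortedSet.range a ⊔ M)) := by
      rw [← hclosure (a := a) hρ (fun s x hx => eρ s (.inr ⟨x.1, hmem hE₁ s ⟨x, Or.inl hx⟩⟩))
        fun s j => eρ s (.inl ⟨a₁ s j, ha₁J s j⟩), SortedSet.image_eq_range,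
        ExpansionIn.toAmbient, SortedSet.image_range]
      exact congrArg SortedSet.range
        (funext fun s => funext fun j => congrArg Subtype.val (eρ s (.inl j)).symm)
    -- Independence moves from `c` to `d` by an automorphism of `𝓤₀` over `B`.
    obtain ⟨σ, hσ, eσ⟩ := hU₀m.exists_automorphism (CardLT.sum hℵ₀ hBs₀ (hJ.mono hκ)) hd
    have hσB : ∀ s, ∀ x ∈ B.carrier s, σ s x = x := fun s x hx => eσ s (.inl ⟨x, hx⟩)
    have hMB : Uplus.toAmbient M ≤ B.carrier := hME ▸ (hME₁.trans hE₁B).1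
    have := hR₀ σ hσ _ _ _ rcs hBs₀ (hamb hMsmall) hRf
    rw [SortedSet.image_eq_self hσB, SortedSet.image_eq_self fun s x hx => hσB s x (hMB s hx),
      SortedSet.image_range, show (fun s x => σ s (c s x)) = fun s j => (d s j).1 from
        funext fun s => funext fun j => eσ s (.inr j), rd, hB] at this
    change R₀ _ _ _
    rwa [hMcl]
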